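/- Setting. Let $H$ be a separable real Hilbert space, let $T\in(0,\infty)$, let $(\Omega,\mathcal F,\mathbb P)$ be a probability space with a normal filtration $(\mathbb F_t)_{t\in[0,T]}$ (right-continuous, with all $\mathbb P$-null events of $\mathcal F$ in $\mathbb F_0$), and let $(W_t)_{t\in[0,T]}$ be an $\mathrm{Id}_H$-cylindrical $(\mathbb F_t)$-Wiener process. Let $\mathbb H\subseteq H$ be an orthonormal basis of $H$, let $\lambda\colon\mathbb H\to\mathbb R$ satisfy $\sup_{h\in\mathbb H}\lambda_h<0$, and let $A\colon D(A)\subseteq H\to H$ be the operator with $D(A)=\{v\in H:\sum_{h\in\mathbb H}|\lambda_h\langle h,v\rangle_H|^2<\infty\}$ and $Av=\sum_{h\in\mathbb H}\lambda_h\langle h,v\rangle_H h$. Let $(H_r)_{r\in\mathbb R}$ be the interpolation spaces associated to $-A$: the elements of $H_r$ are the formal series $u=\sum_{h\in\mathbb H}u_h h$ with real coefficients and $\|u\|_{H_r}^2=\sum_{h\in\mathbb H}|\lambda_h|^{2r}|u_h|^2<\infty$ (so $H_0=H$), and $A$ acts by $Au=\sum_{h\in\mathbb H}\lambda_hu_hh$.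 Let $\mathbf H_0=H_0\times H_{-1/2}$ and $\mathbf H_1=H_{1/2}\times H_0$ with the Hilbert space product norms. For $I\subseteq\mathbb H$ let $\mathbf P_I(v,w)=\bigl(\sum_{h\in I}v_hh,\sum_{h\in I}w_hh\bigr)$ for $(v,w)\in\mathbf H_0$. Let $\mathbf A\colon D(\mathbf A)=\mathbf H_1\subseteq\mathbf H_0\to\mathbf H_0$ be given by $\mathbf A(v,w)=(w,Av)$, and let $(e^{t\mathbf A})_{t\ge0}$ be the strongly continuous semigroup on $\mathbf H_0$ generated by $\mathbf A$. Let $\mu\colon\mathbb H\to\mathbb R$ satisfy $\sum_{h\in\mathbb H}|\mu_h|^2/|\lambda_h|<\infty$, and let $\mathbf B\colon H\to\mathbf H_0$ be the Hilbert–Schmidt operator $\mathbf Bv=\bigl(0,\sum_{h\in\mathbb H}\mu_h\langle h,v\rangle_Hh\bigr)$. For every $I\subseteq\mathbb H$ let $\mathbf X^I\colon\Omega\to\mathbf P_I(\mathbf H_0)$ be a random variable with, $\mathbb P$-almost surely, $$\mathbf X^I=\int_0^Te^{(T-s)\mathbf A}\,\mathbf P_I\mathbf B\,dW_s .$$ Statement.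 Let $c\in(0,\infty)$, $p\in(1,\infty)$, let $e\colon\mathbb N=\{1,2,\dots\}\to\mathbb H$ be a bijection with $\lambda_{e_n}=-c\,n^p$ for all $n\in\mathbb N$, and let $I_N=\{e_1,\dots,e_N\}$ for $N\in\mathbb N$. Then for every $N\in\mathbb N$ the random variables $\mathbf X^{\mathbb H}$ and $\mathbf X^{I_N}$ are square integrable and $$\mathbb E\bigl[\|\mathbf X^{\mathbb H}\|_{\mathbf H_0}^2\bigr]-\mathbb E\bigl[\|\mathbf X^{I_N}\|_{\mathbf H_0}^2\bigr]\;\ge\;\frac{T\,\inf_{h\in\mathbb H}|\mu_h|^2\,N^{1-p}}{c\,(p-1)\,2^{p-1}} .$$ -/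

import Mathlib

open MeasureTheory ProbabilityTheory Filter Topology
open scoped ENNReal NNReal

noncomputable section

namespace StochWave

/-! ### Interpolation spaces of a diagonal operator -/

/-- A family of real numbers whose supremum is negative: the eigenvalues of the diagonal
operator `A = ∑ i, Λ i ⟨b i, ·⟩ b i` with respect to an orthonormal basis `b`. (The supremum of a
family that is empty or not bounded above is `0` in Lean, so such families are excluded.) -/
structure NegEigenvalues (ι : Type*) where
  val : ι → ℝ
  iSup_neg : ⨆ i, val i < 0

namespace NegEigenvalues

variable {ι : Type*} (Λ : NegEigenvalues ι)

theorem neg (i : ι) : Λ.val i < 0 := by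
  have hb : BddAbove (Set.range Λ.val) := by
    by_contra h
    exact absurd Λ.iSup_neg (by rw [Real.iSup_of_not_bddAbove h]; exact lt_irrefl _)
  exact (le_ciSup hb i).trans_lt Λ.iSup_neg

/-- `i`-th eigenvalue of `(-A)^r`. -/
def weight (r : ℝ) (i : ι) : ℝ := |Λ.val i| ^ r

theorem weight_pos (r : ℝ) (i : ι) : 0 < Λ.weight r i :=
  Real.rpow_pos_of_pos (abs_pos.2 (Λ.neg i).ne) r

/-- Coefficient families `u` (with respect to the orthonormal basis of eigenvectors of `A`) such
that `(-A)^r u` is square summable. -/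
def interpSubmodule (r : ℝ) : Submodule ℝ (ι → ℝ) where
  carrier := {u | Memℓp (fun i => Λ.weight r i * u i) 2}
  zero_mem' := by
    have e : (fun i => Λ.weight r i * (0 : ι → ℝ) i) = 0 := by ext i; simp
    change Memℓp (fun i => Λ.weight r i * (0 : ι → ℝ) i) 2
    rw [e]; exact zero_memℓp
  add_mem' {u v} hu hv := by
    have h := Memℓp.add hu hv
    have e : (fun i => Λ.weight r i * (u + v) i)
        = (fun i => Λ.weight r i * u i) + (fun i => Λ.weight r i * v i) := by
      ext i; simp [mul_add]
    change Memℓp (fun i => Λ.weight r i * (u + v) i) 2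
    rw [e]; exact h
  smul_mem' a u hu := by
    have h := Memℓp.const_smul hu a
    have e : (fun i => Λ.weight r i * (a • u) i) = a • (fun i => Λ.weight r i * u i) := by
      ext i; simp; ring
    change Memℓp (fun i => Λ.weight r i * (a • u) i) 2
    rw [e]; exact h

/-- The interpolation space `H_r` associated to `-A`. An element is given by its coefficients
`u i` with respect to the orthonormal basis `b` of eigenvectors of `A` (formally
`u = ∑ i, u i • b i`), and `‖u‖_{H_r} = ‖(-A)^r u‖`. A vector `v` of `H` has the coefficients
`⟨b i, v⟩`, which identifies `H` with `H_0`. -/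
def InterpSpace (r : ℝ) : Type _ := Λ.interpSubmodule r

namespace InterpSpace

variable {Λ} {r : ℝ}

instance : AddCommGroup (Λ.InterpSpace r) :=
  inferInstanceAs (AddCommGroup (Λ.interpSubmodule r))

instance : Module ℝ (Λ.InterpSpace r) :=
  inferInstanceAs (Module ℝ (Λ.interpSubmodule r))

/-- The coefficients of an element of `H_r`. -/
def coeff : Λ.InterpSpace r →ₗ[ℝ] (ι → ℝ) := (Λ.interpSubmodule r).subtype

theorem coeff_mem (u : Λ.InterpSpace r) : coeff u ∈ Λ.interpSubmodule r := Subtype.property u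

theorem coeff_injective : Function.Injective (coeff : Λ.InterpSpace r → ι → ℝ) :=
  Subtype.val_injective

/-- The element of `H_r` with given coefficients. -/
def ofCoeff (u : ι → ℝ) (hu : u ∈ Λ.interpSubmodule r) : Λ.InterpSpace r := ⟨u, hu⟩

@[simp] theorem coeff_ofCoeff (u : ι → ℝ) (hu : u ∈ Λ.interpSubmodule r) :
    coeff (ofCoeff u hu) = u := rfl

/-- The isomorphism `(-A)^r` from `H_r` to `ℓ²`. -/
def toL2 : Λ.InterpSpace r →ₗ[ℝ] lp (fun _ : ι => ℝ) 2 where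
  toFun u := ⟨fun i => Λ.weight r i * coeff u i, coeff_mem u⟩
  map_add' u v := by
    ext i
    change Λ.weight r i * coeff (u + v) i = Λ.weight r i * coeff u i + Λ.weight r i * coeff v i
    rw [map_add, Pi.add_apply, mul_add]
  map_smul' a u := by
    ext i
    change Λ.weight r i * coeff (a • u) i = a * (Λ.weight r i * coeff u i)
    rw [map_smul, Pi.smul_apply, smul_eq_mul]; ring

theorem toL2_apply (u : Λ.InterpSpace r) (i : ι) : toL2 u i = Λ.weight r i * coeff u i := rfl

theorem toL2_injective : Function.Injective (toL2 : Λ.InterpSpace r → lp (fun _ : ι => ℝ) 2) := by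
  intro u v h
  apply coeff_injective
  ext i
  have := congrArg (fun f : lp (fun _ : ι => ℝ) 2 => f i) h
  simp only [toL2_apply] at this
  exact mul_left_cancel₀ (Λ.weight_pos r i).ne' this

theorem toL2_surjective :
    Function.Surjective (toL2 : Λ.InterpSpace r → lp (fun _ : ι => ℝ) 2) := by
  intro f
  have e : (fun i => Λ.weight r i * ((Λ.weight r i)⁻¹ * f i)) = f := by
    ext i; exact mul_inv_cancel_left₀ (Λ.weight_pos r i).ne' _
  refine ⟨ofCoeff (fun i => (Λ.weight r i)⁻¹ * f i) ?_, ?_⟩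
  · change Memℓp (fun i => Λ.weight r i * ((Λ.weight r i)⁻¹ * f i)) 2
    rw [e]; exact lp.memℓp f
  · ext i; exact congrFun e i

instance : NormedAddCommGroup (Λ.InterpSpace r) :=
  NormedAddCommGroup.induced _ _ toL2 toL2_injective

theorem norm_def (u : Λ.InterpSpace r) : ‖u‖ = ‖toL2 u‖ := rfl

/-- `⟨u, v⟩_{H_r} = ⟨(-A)^r u, (-A)^r v⟩`. -/
instance : InnerProductSpace ℝ (Λ.InterpSpace r) where
  norm_smul_le a u := by simp only [norm_def, map_smul, norm_smul, le_refl]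
  inner u v := inner ℝ (toL2 u) (toL2 v)
  norm_sq_eq_re_inner u := by rw [norm_def]; exact norm_sq_eq_re_inner (𝕜 := ℝ) (toL2 u)
  conj_inner_symm u v := inner_conj_symm (𝕜 := ℝ) (toL2 u) (toL2 v)
  add_left u v w := by simp only [map_add, inner_add_left]
  smul_left u v a := by simp only [map_smul, inner_smul_left]

theorem isometry_toL2 :
    Isometry (toL2 : Λ.InterpSpace r → lp (fun _ : ι => ℝ) 2) :=
  AddMonoidHomClass.isometry_of_norm toL2 fun _ => rfl

instance : CompleteSpace (Λ.InterpSpace r) :=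
  (completeSpace_iff_isComplete_range isometry_toL2.isUniformInducing).2 <| by
    rw [toL2_surjective.range_eq]; exact isComplete_univ

theorem mem_interpSubmodule_iff (u : ι → ℝ) :
    u ∈ Λ.interpSubmodule r ↔ Summable fun i => (Λ.weight r i * u i) ^ 2 := by
  change Memℓp (fun i => Λ.weight r i * u i) 2 ↔ _
  rw [memℓp_gen_iff (by norm_num)]
  simp [← abs_mul]

theorem norm_sq_eq (u : Λ.InterpSpace r) :
    ‖u‖ ^ 2 = ∑' i, (Λ.weight r i * coeff u i) ^ 2 := by
  have h := lp.norm_rpow_eq_tsum (p := 2) (by norm_num) (toL2 u)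
  simpa [toL2_apply, norm_def, ← abs_mul] using h

end InterpSpace

open InterpSpace

/-! ### The phase space of the wave equation -/

/-- The Hilbert space `𝐇_0 = H_0 × H_{-1/2}` (with the Hilbert space norm of a product). -/
abbrev WaveSpace : Type _ := WithLp 2 (Λ.InterpSpace 0 × Λ.InterpSpace (-(1 / 2)))

variable {Λ} in
theorem indicator_mem {r : ℝ} (I : Set ι) (u : Λ.InterpSpace r) :
    I.indicator (coeff u) ∈ Λ.interpSubmodule r := by
  rw [mem_interpSubmodule_iff]
  refine Summable.of_nonneg_of_le (fun i => sq_nonneg _) (fun i => ?_)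
    ((mem_interpSubmodule_iff _).1 (coeff_mem u))
  by_cases hi : i ∈ I <;> simp [hi, sq_nonneg, mul_pow, mul_nonneg]

/-- The spectral projection `P_I` on `H_r`: it keeps the coefficients with index in `I` and
deletes the others. -/
def proj (r : ℝ) (I : Set ι) : Λ.InterpSpace r →L[ℝ] Λ.InterpSpace r :=
  LinearMap.mkContinuous
    { toFun := fun u => ofCoeff (I.indicator (coeff u)) (indicator_mem I u)
      map_add' := fun u v => coeff_injective (by simp [Set.indicator_add'])
      map_smul' := fun a u => coeff_injective (by
        simp only [map_smul, coeff_ofCoeff, RingHom.id_apply]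
        exact Set.indicator_const_smul I a (coeff u)) } 1 fun u => by
    rw [one_mul]
    refine le_of_sq_le_sq ?_ (norm_nonneg _)
    rw [norm_sq_eq, norm_sq_eq]
    refine Summable.tsum_le_tsum (fun i => ?_) ((mem_interpSubmodule_iff _).1 (coeff_mem _))
      ((mem_interpSubmodule_iff _).1 (coeff_mem u))
    by_cases hi : i ∈ I <;> simp [hi, sq_nonneg, mul_pow, mul_nonneg]

/-- The projection `𝐏_I (v, w) = (P_I v, P_I w)` on `𝐇_0`. -/
def waveProj (I : Set ι) : Λ.WaveSpace →L[ℝ] Λ.WaveSpace :=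
  ((WithLp.prodContinuousLinearEquiv 2 ℝ (Λ.InterpSpace 0)
      (Λ.InterpSpace (-(1 / 2)))).symm.toContinuousLinearMap ∘L
    (Λ.proj 0 I).prodMap (Λ.proj (-(1 / 2)) I)) ∘L
      (WithLp.prodContinuousLinearEquiv 2 ℝ (Λ.InterpSpace 0)
        (Λ.InterpSpace (-(1 / 2)))).toContinuousLinearMap

/-- The domain `𝐇_1 = H_{1/2} × H_0` of the wave operator, as a subspace of `𝐇_0`. -/
def waveDomain : Submodule ℝ Λ.WaveSpace where
  carrier := {x | coeff x.fst ∈ Λ.interpSubmodule (1 / 2) ∧ coeff x.snd ∈ Λ.interpSubmodule 0}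
  zero_mem' := ⟨by simp, by simp⟩
  add_mem' {x y} hx hy := ⟨by simpa using Submodule.add_mem _ hx.1 hy.1,
    by simpa using Submodule.add_mem _ hx.2 hy.2⟩
  smul_mem' a x hx := ⟨by simpa using Submodule.smul_mem _ a hx.1,
    by simpa using Submodule.smul_mem _ a hx.2⟩

variable {Λ} in
theorem mul_mem {u : ι → ℝ} (hu : u ∈ Λ.interpSubmodule (1 / 2)) :
    (fun i => Λ.val i * u i) ∈ Λ.interpSubmodule (-(1 / 2)) := by
  rw [mem_interpSubmodule_iff] at hu ⊢
  convert hu using 2 with i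
  have h0 : 0 < |Λ.val i| := abs_pos.2 (Λ.neg i).ne
  have h : Λ.weight (1 / 2) i = Λ.weight (-(1 / 2)) i * |Λ.val i| := by
    unfold weight
    rw [← Real.rpow_add_one h0.ne']; norm_num
  rw [h, mul_pow, mul_pow, mul_pow, mul_pow, sq_abs]; ring

/-- The wave operator `𝐀 : D(𝐀) = 𝐇_1 ⊆ 𝐇_0 → 𝐇_0`, `𝐀 (v, w) = (w, A v)`, where `A` multiplies
the `i`-th coefficient by `Λ i`. -/
def waveOp : Λ.WaveSpace →ₗ.[ℝ] Λ.WaveSpace where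
  domain := Λ.waveDomain
  toFun :=
    { toFun := fun x => WithLp.toLp 2
        (ofCoeff (coeff x.1.snd) x.2.2, ofCoeff (fun i => Λ.val i * coeff x.1.fst i) (mul_mem x.2.1))
      map_add' := fun x y => by
        apply WithLp.ofLp_injective
        refine Prod.ext (coeff_injective ?_) (coeff_injective ?_)
        · simp
        · ext i; simp [mul_add]
      map_smul' := fun a x => by
        apply WithLp.ofLp_injective
        refine Prod.ext (coeff_injective ?_) (coeff_injective ?_)
        · simp
        · ext i; simp; ring }

section Noise

variable {H : Type*} [NormedAddCommGroup H] [InnerProductSpace ℝ H]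
  (b : HilbertBasis ι ℝ H) (m : ι → ℝ) (hm : Summable fun i => |m i| ^ 2 / |Λ.val i|)

variable {Λ m} in
theorem noise_term_le (v : H) (i : ι) :
    (Λ.weight (-(1 / 2)) i * (m i * inner ℝ (b i) v)) ^ 2
      ≤ |m i| ^ 2 / |Λ.val i| * ‖v‖ ^ 2 := by
  have h0 : 0 < |Λ.val i| := abs_pos.2 (Λ.neg i).ne
  have h1 : Λ.weight (-(1 / 2)) i ^ 2 = |Λ.val i|⁻¹ := by
    unfold weight
    rw [← Real.rpow_natCast, ← Real.rpow_mul h0.le, ← Real.rpow_neg_one]; norm_num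
  have h2 : (inner ℝ (b i) v) ^ 2 ≤ ‖v‖ ^ 2 := by
    refine sq_le_sq' ?_ ?_
    · have := neg_le_of_abs_le (abs_real_inner_le_norm (b i) v)
      rwa [b.orthonormal.1 i, one_mul] at this
    · have := real_inner_le_norm (b i) v
      rwa [b.orthonormal.1 i, one_mul] at this
  calc _ = |m i| ^ 2 / |Λ.val i| * (inner ℝ (b i) v) ^ 2 := by
        rw [mul_pow, mul_pow, h1, sq_abs]; ring
    _ ≤ _ := by gcongr

variable {Λ m} in
theorem noise_mem (hm : Summable fun i => |m i| ^ 2 / |Λ.val i|) (v : H) :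
    (fun i => m i * inner ℝ (b i) v) ∈ Λ.interpSubmodule (-(1 / 2)) := by
  rw [mem_interpSubmodule_iff]
  exact Summable.of_nonneg_of_le (fun i => sq_nonneg _) (noise_term_le b v) (hm.mul_right _)

/-- The noise operator `𝐁 v = (0, ∑ i, m i ⟨b i, v⟩ b i)` from `H` to `𝐇_0`. -/
def noiseOp : H →L[ℝ] Λ.WaveSpace :=
  LinearMap.mkContinuous
    { toFun := fun v => WithLp.toLp 2 (0, ofCoeff (fun i => m i * inner ℝ (b i) v) (noise_mem b hm v))
      map_add' := fun v w => by
        apply WithLp.ofLp_injective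
        refine Prod.ext (by simp) (coeff_injective ?_)
        ext i; simp [inner_add_right, mul_add]
      map_smul' := fun a v => by
        apply WithLp.ofLp_injective
        refine Prod.ext (by simp) (coeff_injective ?_)
        ext i; simp [inner_smul_right]; ring }
    (√(∑' i, |m i| ^ 2 / |Λ.val i|)) fun v => by
      have hs : 0 ≤ ∑' i, |m i| ^ 2 / |Λ.val i| := tsum_nonneg fun i => by positivity
      refine le_of_sq_le_sq ?_ (by positivity)
      rw [WithLp.prod_norm_sq_eq_of_L2, mul_pow, Real.sq_sqrt hs]
      simp only [LinearMap.coe_mk, AddHom.coe_mk, norm_sq_eq]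
      rw [← tsum_mul_right]
      simpa using Summable.tsum_le_tsum (noise_term_le b v)
        ((mem_interpSubmodule_iff _).1 (noise_mem b hm v)) (hm.mul_right _)

end Noise

end NegEigenvalues

/-! ### Strongly continuous semigroups -/

section Semigroup

variable {E : Type*} [NormedAddCommGroup E] [NormedSpace ℝ E]

/-- `S t`, `t ≥ 0`, is a strongly continuous semigroup of bounded operators whose generator is
the (in general unbounded) operator `A`. -/
structure IsSemigroupGeneratedBy (S : ℝ → E →L[ℝ] E) (A : E →ₗ.[ℝ] E) : Prop where
  zero : S 0 = ContinuousLinearMap.id ℝ E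
  add : ∀ s t, 0 ≤ s → 0 ≤ t → S (s + t) = S s ∘L S t
  continuousOn : ∀ x, ContinuousOn (fun t => S t x) (Set.Ici 0)
  generator : ∀ x y, (x, y) ∈ A.graph ↔
    Tendsto (fun t : ℝ => t⁻¹ • (S t x - x)) (𝓝[>] 0) (𝓝 y)

/-- The semigroup `t ↦ e^{tA}`, `t ≥ 0`, generated by `A`. -/
def expSemigroup (A : E →ₗ.[ℝ] E) : ℝ → E →L[ℝ] E :=
  Classical.epsilon fun S => IsSemigroupGeneratedBy S A

end Semigroup

/-! ### Cylindrical Wiener processes and stochastic integrals -/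

section Wiener

variable {Ω : Type*} {mΩ : MeasurableSpace Ω} {T : ℝ}

/-- A filtration on `[0, T]` is normal if it is right-continuous and the σ-algebra at time `0`
contains all null events. -/
structure IsNormalFiltration (P : Measure Ω) (𝓕 : Filtration (Set.Icc (0 : ℝ) T) mΩ) : Prop where
  rightCont : ∀ t : Set.Icc (0 : ℝ) T, (t : ℝ) < T → (⨅ s > t, 𝓕 s) ≤ 𝓕 t
  null : ∀ s : Set Ω, MeasurableSet s → P s = 0 →
    ∀ t : Set.Icc (0 : ℝ) T, (t : ℝ) = 0 → MeasurableSet[𝓕 t] s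

variable {H : Type*} [NormedAddCommGroup H] [InnerProductSpace ℝ H]

/-- `W` is an `Id_H`-cylindrical Wiener process on `[0, T]` with respect to the filtration `𝓕`;
the random variable `W t v` is `⟨v, W_t⟩_H`. -/
structure IsCylindricalWiener (P : Measure Ω) (𝓕 : Filtration (Set.Icc (0 : ℝ) T) mΩ)
    (W : Set.Icc (0 : ℝ) T → H → Ω → ℝ) : Prop where
  linear : ∀ t (a c : ℝ) (v w : H),
    ∀ᵐ ω ∂P, W t (a • v + c • w) ω = a * W t v ω + c * W t w ω
  adapted : ∀ v t, Measurable[𝓕 t] (W t v)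
  zero : ∀ v (t : Set.Icc (0 : ℝ) T), (t : ℝ) = 0 → ∀ᵐ ω ∂P, W t v ω = 0
  continuous : ∀ v, ∀ᵐ ω ∂P, Continuous fun t => W t v ω
  indep : ∀ v s t, s ≤ t →
    Indep (MeasurableSpace.comap (fun ω => W t v ω - W s v ω) inferInstance) (𝓕 s) P
  law : ∀ v (s t : Set.Icc (0 : ℝ) T), s ≤ t →
    P.map (fun ω => W t v ω - W s v ω) = gaussianReal 0 (((t : ℝ) - s) * ‖v‖ ^ 2).toNNReal

variable {E : Type*} [NormedAddCommGroup E] [NormedSpace ℝ E]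

variable (H E T) in
/-- Data of an elementary integrand: the finite rank step function
`∑ j, 1_{(s j, t j]} ⟨a j, ·⟩ u j` from `[0, T]` to the bounded operators from `H` to `E`. -/
structure ElementaryIntegrand where
  n : ℕ
  s : Fin n → Set.Icc (0 : ℝ) T
  t : Fin n → Set.Icc (0 : ℝ) T
  le : ∀ j, s j ≤ t j
  a : Fin n → H
  u : Fin n → E

namespace ElementaryIntegrand

/-- The step function with the given data. -/
def toFun (Ψ : ElementaryIntegrand T H E) (r : ℝ) : H →L[ℝ] E :=
  ∑ j, (Set.Ioc (Ψ.s j : ℝ) (Ψ.t j)).indicator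
    (fun _ => (innerSL ℝ (Ψ.a j)).smulRight (Ψ.u j)) r

/-- The stochastic integral of an elementary integrand,
`∑ j, ⟨a j, W_{t j} - W_{s j}⟩ u j`. -/
def integral (Ψ : ElementaryIntegrand T H E) (W : Set.Icc (0 : ℝ) T → H → Ω → ℝ) (ω : Ω) : E :=
  ∑ j, (W (Ψ.t j) (Ψ.a j) ω - W (Ψ.s j) (Ψ.a j) ω) • Ψ.u j

end ElementaryIntegrand

/-- The square of the Hilbert-Schmidt norm (possibly `∞`), computed with an orthonormal
basis `b`, on which it does not depend when `E` is a Hilbert space. -/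
def hsNormSq {ι : Type*} (b : HilbertBasis ι ℝ H) (L : H →L[ℝ] E) : ℝ≥0∞ :=
  ∑' i, ‖L (b i)‖ₑ ^ 2

/-- `X = ∫_0^T Φ_s dW_s` almost surely, for a deterministic integrand `Φ`: there are elementary
integrands that converge to `Φ` in `L²([0, T]; HS(H, E))` and whose stochastic integrals converge
to `X` in `L²(P; E)`. (By Itô's isometry the limit is almost surely unique, and it does not depend
on the approximating sequence.) -/
def IsStochasticIntegral {ι : Type*} (P : Measure Ω) (W : Set.Icc (0 : ℝ) T → H → Ω → ℝ)
    (b : HilbertBasis ι ℝ H) (Φ : ℝ → H →L[ℝ] E) (X : Ω → E) : Prop :=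
  AEStronglyMeasurable X P ∧ ∃ Ψ : ℕ → ElementaryIntegrand T H E,
    Tendsto (fun k => ∫⁻ r in Set.Icc 0 T, hsNormSq b ((Ψ k).toFun r - Φ r)) atTop (𝓝 0) ∧
    Tendsto (fun k => eLpNorm (fun ω => X ω - (Ψ k).integral W ω) 2 P) atTop (𝓝 0)

end Wiener

end StochWave

end

/-!
In the complex coordinates `z i = v i - I * w i / |Λ i| ^ (1/2)` of the phase space
`H_0 × H_{-1/2}`, which identify it isometrically with the complex `ℓ²` (`phaseEquiv`), the wave
operator is multiplication by `I * |Λ i| ^ (1/2)` on its maximal domain (`mem_graph_waveOp_iff`).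
Hence rotation of the coordinates is a strongly continuous group with this generator
(`waveGroup_isSemigroup`). Every semigroup generated by the wave operator acts in this way on the
domain, since each coordinate solves a scalar linear differential equation
(`phaseEquiv_semigroup`); in particular the semigroup is isometric there.

The noise operator, followed by a spectral projection, maps a basis vector `b i` into that domain,
to a vector whose squared norm is `|m i| ^ 2 / |Λ i|` if `i ∈ I` and zero otherwise. So the
Hilbert-Schmidt norm of the integrand does not depend on time (`hsNormSq_integrand`), and Itô's
isometry (`IsStochasticIntegral.ito_isometry`) gives
`E ‖X I‖ ^ 2 = T * ∑_{i ∈ I} |m i| ^ 2 / |Λ i|` (`second_moment`). For elementary integrands Itô's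
isometry amounts to the covariance `E (W s v * W t w) = min s t * ⟨v, w⟩` of the Wiener process and
Parseval's identity; the general case follows by approximation.

The difference of the two second moments is therefore `T * ∑_{n > N} |m (e n)| ^ 2 / (c * n ^ p)`.
The claimed bound comes from
`∑_{n > N} n ^ (-p) ≥ (N + 1) ^ (1 - p) / (p - 1) ≥ (2 * N) ^ (1 - p) / (p - 1)`, where the first
inequality is obtained by telescoping (`rpow_le_tsum_tail`).
-/

noncomputable section

namespace StochWave

/-! ### Dominated convergence in `ℓ²` and diagonal unitary groups -/

section Diagonal

variable {ι : Type*}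

theorem memℓp_two_iff (f : ι → ℂ) : Memℓp f 2 ↔ Summable fun i => ‖f i‖ ^ 2 := by
  rw [memℓp_gen_iff (by norm_num)]
  simp

theorem lp_two_norm_sq (f : lp (fun _ : ι => ℂ) 2) : ‖f‖ ^ 2 = ∑' i, ‖f i‖ ^ 2 := by
  simpa using lp.norm_rpow_eq_tsum (p := 2) (by norm_num) f

/-- Dominated convergence in `ℓ²`. -/
theorem lp_tendsto_of_dominated {α : Type*} {l : Filter α} {F : α → lp (fun _ : ι => ℂ) 2}
    {g : lp (fun _ : ι => ℂ) 2} {B : ι → ℝ} (hB : Summable fun i => B i ^ 2)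
    (hle : ∀ᶠ a in l, ∀ i, ‖F a i - g i‖ ≤ B i)
    (hlim : ∀ i, Tendsto (fun a => F a i) l (𝓝 (g i))) : Tendsto F l (𝓝 g) := by
  rw [tendsto_iff_norm_sub_tendsto_zero]
  have h : Tendsto (fun a => ‖F a - g‖ ^ 2) l (𝓝 0) := by
    have h1 : Tendsto (fun a => ∑' i, ‖F a i - g i‖ ^ 2) l (𝓝 (∑' _ : ι, (0 : ℝ))) := by
      refine tendsto_tsum_of_dominated_convergence hB (fun i => ?_) ?_
      · have := ((hlim i).sub_const (g i)).norm.pow 2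
        simpa using this
      · filter_upwards [hle] with a ha i
        rw [Real.norm_of_nonneg (sq_nonneg _)]
        exact pow_le_pow_left₀ (norm_nonneg _) (ha i) 2
    simpa [lp_two_norm_sq] using h1
  simpa [Real.sqrt_sq (norm_nonneg _)] using h.sqrt

theorem continuous_lp_apply (i : ι) : Continuous fun f : lp (fun _ : ι => ℂ) 2 => f i :=
  (lp.evalCLM ℝ (fun _ : ι => ℂ) (p := 2) i).continuous

theorem norm_exp_I_mul (x : ℝ) : ‖Complex.exp (Complex.I * x)‖ = 1 := by
  rw [mul_comm]; exact Complex.norm_exp_ofReal_mul_I x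

/-- The isometry `f ↦ (i ↦ e^{I θ i} f i)` of `ℓ²`. -/
def phase (θ : ι → ℝ) : lp (fun _ : ι => ℂ) 2 →ₗᵢ[ℝ] lp (fun _ : ι => ℂ) 2 where
  toFun f := ⟨fun i => Complex.exp (Complex.I * θ i) * f i, by
    have h := (memℓp_two_iff _).1 (lp.memℓp f)
    refine (memℓp_two_iff _).2 ?_
    simpa [norm_exp_I_mul] using h⟩
  map_add' f g := by
    ext i; exact mul_add _ _ _
  map_smul' a f := by
    ext i; exact mul_smul_comm a _ _
  norm_map' f := by
    refine (sq_eq_sq₀ (norm_nonneg _) (norm_nonneg _)).1 ?_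
    rw [lp_two_norm_sq, lp_two_norm_sq]
    refine tsum_congr fun i => ?_
    change ‖Complex.exp (Complex.I * θ i) * f i‖ ^ 2 = _
    rw [norm_mul, norm_exp_I_mul, one_mul]

theorem phase_apply (θ : ι → ℝ) (f : lp (fun _ : ι => ℂ) 2) (i : ι) :
    phase θ f i = Complex.exp (Complex.I * θ i) * f i := rfl

theorem hasDerivAt_exp_I_mul (w t : ℝ) :
    HasDerivAt (fun t : ℝ => Complex.exp (Complex.I * (t * w : ℝ)))
      (Complex.I * w * Complex.exp (Complex.I * (t * w : ℝ))) t := by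
  have h1 : HasDerivAt (fun t : ℝ => Complex.I * ((t * w : ℝ) : ℂ)) (Complex.I * w) t := by
    have := ((hasDerivAt_id t).mul_const w).ofReal_comp.const_mul Complex.I
    simpa using this
  convert h1.cexp using 1
  ring

theorem continuous_phase (w : ι → ℝ) (f : lp (fun _ : ι => ℂ) 2) :
    Continuous fun t : ℝ => phase (fun i => t * w i) f := by
  rw [continuous_iff_continuousAt]
  intro t
  refine lp_tendsto_of_dominated (B := fun i => 2 * ‖f i‖) ?_ (.of_forall fun s i => ?_) fun i => ?_
  · simpa only [mul_pow] using ((memℓp_two_iff _).1 (lp.memℓp f)).mul_left (2 ^ 2)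
  · refine (norm_sub_le _ _).trans (le_of_eq ?_)
    rw [phase_apply, phase_apply, norm_mul, norm_mul, norm_exp_I_mul, norm_exp_I_mul]
    ring
  · simp only [phase_apply]
    exact (hasDerivAt_exp_I_mul (w i) t).continuousAt.tendsto.mul_const (f i)

/-- The generator of the unitary group `t ↦ phase (t w)` is multiplication by `I w`, on its
maximal domain. -/
theorem phase_generator_iff (w : ι → ℝ) (f g : lp (fun _ : ι => ℂ) 2) :
    (∀ i, g i = Complex.I * w i * f i) ↔
      Tendsto (fun t : ℝ => t⁻¹ • (phase (fun i => t * w i) f - f)) (𝓝[>] 0) (𝓝 g) := by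
  have hpt : ∀ i, Tendsto (fun t : ℝ => (t⁻¹ • (phase (fun i => t * w i) f - f)) i) (𝓝[>] 0)
      (𝓝 (Complex.I * w i * f i)) := by
    intro i
    have h := ((hasDerivAt_exp_I_mul (w i) 0).mul_const (f i)).hasDerivWithinAt (s := Set.Ioi 0)
    rw [hasDerivWithinAt_iff_tendsto_slope' (by simp)] at h
    simp only [zero_mul, Complex.ofReal_zero, mul_zero, Complex.exp_zero, mul_one] at h
    refine h.congr fun t => ?_
    rw [slope_def_module, lp.coeFn_smul, Pi.smul_apply, lp.coeFn_sub, Pi.sub_apply, phase_apply]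
    simp
  constructor
  · intro hg
    refine lp_tendsto_of_dominated (B := fun i => 2 * ‖g i‖) ?_ ?_ fun i => hg i ▸ hpt i
    · simpa only [mul_pow] using ((memℓp_two_iff _).1 (lp.memℓp g)).mul_left (2 ^ 2)
    · filter_upwards [self_mem_nhdsWithin] with t ht i
      refine (norm_sub_le _ _).trans ?_
      rw [two_mul]
      refine add_le_add ?_ le_rfl
      rw [lp.coeFn_smul, Pi.smul_apply, lp.coeFn_sub, Pi.sub_apply, phase_apply, ← sub_one_mul,
        norm_smul, norm_mul, hg i, norm_mul, norm_mul, Complex.norm_I, one_mul,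
        Complex.norm_real, norm_inv]
      have h0 : 0 < ‖t‖ := norm_pos_iff.2 (ne_of_gt ht)
      have := Real.norm_exp_I_mul_ofReal_sub_one_le (x := t * w i)
      rw [norm_mul t] at this
      rw [inv_mul_le_iff₀ h0, ← mul_assoc]
      exact mul_le_mul_of_nonneg_right this (norm_nonneg _)
  · intro h i
    exact tendsto_nhds_unique (((continuous_lp_apply i).tendsto g).comp h) (hpt i)

end Diagonal

/-! ### The wave semigroup -/

namespace NegEigenvalues

open InterpSpace

variable {ι : Type*} (Λ : NegEigenvalues ι)

/-- The frequency `|Λ i| ^ (1/2)` of the `i`-th mode of the wave equation. -/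
abbrev freq (i : ι) : ℝ := Λ.weight (1 / 2) i

theorem freq_pos (i : ι) : 0 < Λ.freq i := Λ.weight_pos _ i

theorem freq_sq (i : ι) : Λ.freq i ^ 2 = |Λ.val i| := by
  rw [freq, weight, ← Real.rpow_natCast, ← Real.rpow_mul (abs_nonneg _)]
  norm_num

theorem val_eq_neg_freq_sq (i : ι) : Λ.val i = -Λ.freq i ^ 2 := by
  rw [freq_sq, abs_of_neg (Λ.neg i), neg_neg]

theorem weight_zero (i : ι) : Λ.weight 0 i = 1 := Real.rpow_zero _

theorem weight_neg_half (i : ι) : Λ.weight (-(1 / 2)) i = (Λ.freq i)⁻¹ :=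
  Real.rpow_neg (abs_nonneg _) _

theorem mem_interp_zero_iff (u : ι → ℝ) :
    u ∈ Λ.interpSubmodule 0 ↔ Summable fun i => u i ^ 2 := by
  rw [mem_interpSubmodule_iff]; simp [weight_zero]

theorem mem_interp_neg_half_iff (u : ι → ℝ) :
    u ∈ Λ.interpSubmodule (-(1 / 2)) ↔ Summable fun i => ((Λ.freq i)⁻¹ * u i) ^ 2 := by
  rw [mem_interpSubmodule_iff]; simp only [weight_neg_half]

theorem norm_sq_mk (a c : ℝ) : ‖(⟨a, c⟩ : ℂ)‖ ^ 2 = a ^ 2 + c ^ 2 := by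
  rw [Complex.sq_norm, Complex.normSq_mk]; ring

/-- The `i`-th complex phase space coordinate `v i - I w i / freq i` of `(v, w)`. -/
def phaseCoord (x : Λ.WaveSpace) (i : ι) : ℂ := ⟨coeff x.fst i, -((Λ.freq i)⁻¹ * coeff x.snd i)⟩

theorem phaseCoord_norm_sq (x : Λ.WaveSpace) (i : ι) :
    ‖Λ.phaseCoord x i‖ ^ 2 = coeff x.fst i ^ 2 + ((Λ.freq i)⁻¹ * coeff x.snd i) ^ 2 := by
  rw [phaseCoord, norm_sq_mk, neg_sq]

theorem summable_fst (x : Λ.WaveSpace) : Summable fun i => coeff x.fst i ^ 2 :=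
  (Λ.mem_interp_zero_iff _).1 (coeff_mem x.fst)

theorem summable_snd (x : Λ.WaveSpace) : Summable fun i => ((Λ.freq i)⁻¹ * coeff x.snd i) ^ 2 :=
  (Λ.mem_interp_neg_half_iff _).1 (coeff_mem x.snd)

/-- The complex phase space coordinates identify `𝐇_0` isometrically with the complex `ℓ²`;
they diagonalize the wave operator. -/
def phaseEquiv : Λ.WaveSpace ≃ₗᵢ[ℝ] lp (fun _ : ι => ℂ) 2 where
  toFun x := ⟨Λ.phaseCoord x, by
    refine (memℓp_two_iff _).2 ?_
    simp only [phaseCoord_norm_sq]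
    exact (Λ.summable_fst x).add (Λ.summable_snd x)⟩
  map_add' x y := by
    ext i
    change Λ.phaseCoord (x + y) i = Λ.phaseCoord x i + Λ.phaseCoord y i
    apply Complex.ext <;> simp [phaseCoord, mul_add]
    ring
  map_smul' a x := by
    ext i
    change Λ.phaseCoord (a • x) i = a • Λ.phaseCoord x i
    apply Complex.ext <;> simp [phaseCoord]
    ring
  invFun f := WithLp.toLp 2
    (ofCoeff (fun i => (f i).re) ((Λ.mem_interp_zero_iff _).2 <| by
        refine Summable.of_nonneg_of_le (fun i => sq_nonneg _) (fun i => ?_)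
          ((memℓp_two_iff _).1 (lp.memℓp f))
        rw [← sq_abs]
        exact pow_le_pow_left₀ (abs_nonneg _) (Complex.abs_re_le_norm _) 2),
      ofCoeff (fun i => -(Λ.freq i * (f i).im)) ((Λ.mem_interp_neg_half_iff _).2 <| by
        refine Summable.of_nonneg_of_le (fun i => sq_nonneg _) (fun i => ?_)
          ((memℓp_two_iff _).1 (lp.memℓp f))
        rw [mul_neg, inv_mul_cancel_left₀ (Λ.freq_pos i).ne', neg_sq, ← sq_abs]
        exact pow_le_pow_left₀ (abs_nonneg _) (Complex.abs_im_le_norm _) 2))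
  left_inv x := by
    apply WithLp.ofLp_injective
    refine Prod.ext (coeff_injective ?_) (coeff_injective ?_)
    · rfl
    · ext i
      change -(Λ.freq i * -((Λ.freq i)⁻¹ * coeff x.snd i)) = coeff x.snd i
      rw [mul_neg, neg_neg, mul_inv_cancel_left₀ (Λ.freq_pos i).ne']
  right_inv f := by
    ext i
    refine Complex.ext rfl ?_
    change -((Λ.freq i)⁻¹ * -(Λ.freq i * (f i).im)) = (f i).im
    rw [mul_neg, neg_neg, inv_mul_cancel_left₀ (Λ.freq_pos i).ne']
  norm_map' x := by
    refine (sq_eq_sq₀ (norm_nonneg _) (norm_nonneg _)).1 ?_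
    rw [lp_two_norm_sq, WithLp.prod_norm_sq_eq_of_L2, norm_sq_eq, norm_sq_eq]
    change ∑' i, ‖Λ.phaseCoord x i‖ ^ 2 = _
    simp only [phaseCoord_norm_sq, weight_zero, weight_neg_half, one_mul]
    exact (Λ.summable_fst x).tsum_add (Λ.summable_snd x)

theorem phaseEquiv_apply (x : Λ.WaveSpace) (i : ι) :
    Λ.phaseEquiv x i = ⟨coeff x.fst i, -((Λ.freq i)⁻¹ * coeff x.snd i)⟩ := rfl

/-- In the complex coordinates the wave operator is multiplication by `I * freq`, on its maximal
domain. -/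
theorem mem_graph_waveOp_iff (x y : Λ.WaveSpace) :
    (x, y) ∈ Λ.waveOp.graph ↔
      ∀ i, Λ.phaseEquiv y i = Complex.I * Λ.freq i * Λ.phaseEquiv x i := by
  have key : (∀ i, Λ.phaseEquiv y i = Complex.I * Λ.freq i * Λ.phaseEquiv x i) ↔
      ∀ i, coeff y.fst i = coeff x.snd i ∧ coeff y.snd i = Λ.val i * coeff x.fst i := by
    refine forall_congr' fun i => ?_
    have h0 := (Λ.freq_pos i).ne'
    rw [phaseEquiv_apply, phaseEquiv_apply, Complex.ext_iff, val_eq_neg_freq_sq]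
    simp only [Complex.mul_re, Complex.mul_im, Complex.I_re, Complex.I_im, Complex.ofReal_re,
      Complex.ofReal_im]
    refine and_congr ?_ ?_
    · rw [show ((0 * Λ.freq i - 1 * 0) * coeff x.fst i -
        (0 * 0 + 1 * Λ.freq i) * -((Λ.freq i)⁻¹ * coeff x.snd i)) = coeff x.snd i by
          field_simp; ring]
    · rw [show ((0 * Λ.freq i - 1 * 0) * -((Λ.freq i)⁻¹ * coeff x.snd i) +
        (0 * 0 + 1 * Λ.freq i) * coeff x.fst i) = Λ.freq i * coeff x.fst i by ring]
      constructor
      · intro h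
        have : Λ.freq i * ((Λ.freq i)⁻¹ * coeff y.snd i) = coeff y.snd i :=
          mul_inv_cancel_left₀ h0 _
        rw [← this]
        rw [neg_eq_iff_eq_neg] at h
        rw [h]; ring
      · intro h
        rw [h]; field_simp
  rw [key, LinearPMap.mem_graph_iff]
  constructor
  · rintro ⟨z, hz, hy⟩ i
    simp only at hz hy
    subst hz hy
    exact ⟨rfl, rfl⟩
  · intro h
    have h1 : x ∈ Λ.waveDomain := by
      constructor
      · rw [mem_interpSubmodule_iff]
        refine (Λ.summable_snd y).congr fun i => ?_
        rw [(h i).2, val_eq_neg_freq_sq]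
        have h0 := (Λ.freq_pos i).ne'
        field_simp
      · rw [mem_interp_zero_iff]
        refine (Λ.summable_fst y).congr fun i => ?_
        rw [(h i).1]
    refine ⟨⟨x, h1⟩, rfl, ?_⟩
    apply WithLp.ofLp_injective
    refine Prod.ext (coeff_injective ?_) (coeff_injective ?_)
    · ext i; exact (h i).1.symm
    · ext i; exact (h i).2.symm

/-- The wave group: rotation with angular velocity `freq i` in the `i`-th complex coordinate. -/
def waveGroup (t : ℝ) : Λ.WaveSpace →L[ℝ] Λ.WaveSpace :=
  Λ.phaseEquiv.symm.toContinuousLinearEquiv.toContinuousLinearMap ∘L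
    (phase fun i => t * Λ.freq i).toContinuousLinearMap ∘L
      Λ.phaseEquiv.toContinuousLinearEquiv.toContinuousLinearMap

theorem waveGroup_apply (t : ℝ) (x : Λ.WaveSpace) :
    Λ.waveGroup t x = Λ.phaseEquiv.symm (phase (fun i => t * Λ.freq i) (Λ.phaseEquiv x)) := rfl

theorem waveGroup_isSemigroup : IsSemigroupGeneratedBy Λ.waveGroup Λ.waveOp where
  zero := by
    ext1 x
    rw [waveGroup_apply, ContinuousLinearMap.id_apply, LinearIsometryEquiv.symm_apply_eq]
    ext i
    simp [phase_apply]
  add s t _ _ := by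
    ext1 x
    rw [ContinuousLinearMap.comp_apply, waveGroup_apply, waveGroup_apply, waveGroup_apply,
      LinearIsometryEquiv.apply_symm_apply]
    congr 1
    ext i
    rw [phase_apply, phase_apply, phase_apply, ← mul_assoc, ← Complex.exp_add]
    congr 2
    push_cast
    ring
  continuousOn x :=
    (Λ.phaseEquiv.symm.continuous.comp (continuous_phase Λ.freq (Λ.phaseEquiv x))).continuousOn
  generator x y := by
    rw [mem_graph_waveOp_iff, phase_generator_iff]
    constructor
    · intro h
      have := (Λ.phaseEquiv.symm.continuous.tendsto _).comp h
      rw [LinearIsometryEquiv.symm_apply_apply] at this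
      refine this.congr fun t => ?_
      rw [Function.comp_apply, map_smul, map_sub, LinearIsometryEquiv.symm_apply_apply,
        waveGroup_apply]
    · intro h
      refine ((Λ.phaseEquiv.continuous.tendsto _).comp h).congr fun t => ?_
      rw [Function.comp_apply, map_smul, map_sub, waveGroup_apply,
        LinearIsometryEquiv.apply_symm_apply]

/-- The semigroup selected in the definition of `expSemigroup` really is generated by the wave
operator: `waveGroup` shows that such a semigroup exists. -/
theorem expSemigroup_waveOp : IsSemigroupGeneratedBy (expSemigroup Λ.waveOp) Λ.waveOp :=
  Classical.epsilon_spec (p := fun S => IsSemigroupGeneratedBy S Λ.waveOp)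
    ⟨_, Λ.waveGroup_isSemigroup⟩

end NegEigenvalues

section SemigroupFlow

variable {E : Type*} [NormedAddCommGroup E] [NormedSpace ℝ E] {S : ℝ → E →L[ℝ] E}
  {A : E →ₗ.[ℝ] E}

/-- The domain of the generator is invariant under the semigroup, and the generator commutes with
the semigroup. -/
theorem IsSemigroupGeneratedBy.apply_mem_graph (hS : IsSemigroupGeneratedBy S A) {x y : E}
    (h : (x, y) ∈ A.graph) {t : ℝ} (ht : 0 ≤ t) : (S t x, S t y) ∈ A.graph := by
  rw [hS.generator] at h ⊢
  refine (((S t).continuous.tendsto _).comp h).congr' ?_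
  filter_upwards [self_mem_nhdsWithin] with s hs
  have hs : 0 < s := hs
  rw [Function.comp_apply, map_smul, map_sub, ← ContinuousLinearMap.comp_apply,
    ← ContinuousLinearMap.comp_apply, ← hS.add t s ht hs.le, ← hS.add s t hs.le ht, add_comm]

theorem IsSemigroupGeneratedBy.hasDerivWithinAt (hS : IsSemigroupGeneratedBy S A) {x y : E}
    (h : (x, y) ∈ A.graph) {t : ℝ} (ht : 0 ≤ t) :
    HasDerivWithinAt (fun s => S s x) (S t y) (Set.Ici t) t := by
  have h1 := (hS.generator _ _).1 (hS.apply_mem_graph h ht)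
  rw [← hasDerivWithinAt_Ioi_iff_Ici, hasDerivWithinAt_iff_tendsto_slope' (by simp)]
  have h2 : Tendsto (fun s => s - t) (𝓝[>] t) (𝓝[>] 0) := by
    refine tendsto_nhdsWithin_iff.2 ⟨?_, ?_⟩
    · have : Tendsto (fun s => s - t) (𝓝 t) (𝓝 (t - t)) :=
        (continuous_id.sub continuous_const).tendsto t
      rw [sub_self] at this
      exact this.mono_left nhdsWithin_le_nhds
    · filter_upwards [self_mem_nhdsWithin] with s hs
      exact sub_pos.2 (Set.mem_Ioi.1 hs)
  refine (h1.comp h2).congr' ?_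
  filter_upwards [self_mem_nhdsWithin] with s hs
  have hs : t < s := hs
  rw [Function.comp_apply, slope_def_module, ← ContinuousLinearMap.comp_apply,
    ← hS.add _ _ (sub_pos.2 hs).le ht, sub_add_cancel]

end SemigroupFlow

namespace NegEigenvalues

variable {ι : Type*} (Λ : NegEigenvalues ι)

/-- A semigroup generated by the wave operator rotates the complex coordinates of the vectors in
the domain: the `i`-th one solves `z' = I * freq i * z`. -/
theorem phaseEquiv_semigroup {S : ℝ → Λ.WaveSpace →L[ℝ] Λ.WaveSpace}
    (hS : IsSemigroupGeneratedBy S Λ.waveOp) {x y : Λ.WaveSpace}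
    (h : (x, y) ∈ Λ.waveOp.graph) {t : ℝ} (ht : 0 ≤ t) :
    Λ.phaseEquiv (S t x) = phase (fun i => t * Λ.freq i) (Λ.phaseEquiv x) := by
  ext i
  -- `e^{-I s freq i} z_i(s)` has right derivative zero
  set w := Λ.freq i with hw
  let L : Λ.WaveSpace →L[ℝ] ℂ := (lp.evalCLM ℝ (fun _ : ι => ℂ) (p := 2) i) ∘L
    Λ.phaseEquiv.toContinuousLinearEquiv.toContinuousLinearMap
  have hL : ∀ z, L z = Λ.phaseEquiv z i := fun _ => rfl
  have hc := constant_of_has_deriv_right_zero (a := 0) (b := t)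
    (f := fun s : ℝ => Complex.exp (Complex.I * (s * (-w) : ℝ)) * L (S s x)) ?_ ?_ t ⟨ht, le_rfl⟩
  · simp only [zero_mul, Complex.ofReal_zero, mul_zero, Complex.exp_zero, one_mul, hS.zero,
      ContinuousLinearMap.id_apply, hL] at hc
    rw [phase_apply, ← hc, ← mul_assoc, ← Complex.exp_add, ← hw]
    have : Complex.I * ((t * w : ℝ) : ℂ) + Complex.I * ((t * -w : ℝ) : ℂ) = 0 := by
      push_cast; ring
    rw [this, Complex.exp_zero, one_mul]
  · refine ContinuousOn.mul (by fun_prop) (L.continuous.comp_continuousOn ?_)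
    exact (hS.continuousOn x).mono Set.Icc_subset_Ici_self
  · intro s hs
    have h1 := (hasDerivAt_exp_I_mul (-w) s).hasDerivWithinAt (s := Set.Ici s)
    have h2 := L.hasFDerivAt.comp_hasDerivWithinAt s (hS.hasDerivWithinAt h hs.1)
    have h3 : L (S s y) = Complex.I * w * L (S s x) :=
      (Λ.mem_graph_waveOp_iff _ _).1 (hS.apply_mem_graph h hs.1) i
    refine (h1.mul h2).congr_deriv ?_
    rw [h3]
    simp only [Function.comp_apply]
    push_cast
    ring

/-- The wave semigroup preserves the norm of `𝐇_0` (on the domain of its generator). -/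
theorem norm_expSemigroup_waveOp {x : Λ.WaveSpace} (hx : x ∈ Λ.waveDomain) {t : ℝ} (ht : 0 ≤ t) :
    ‖expSemigroup Λ.waveOp t x‖ = ‖x‖ := by
  rw [← Λ.phaseEquiv.norm_map, Λ.phaseEquiv_semigroup Λ.expSemigroup_waveOp
    (Λ.waveOp.mem_graph ⟨x, hx⟩) ht, LinearIsometry.norm_map, LinearIsometryEquiv.norm_map]

end NegEigenvalues

/-! ### Second moments of a cylindrical Wiener process -/

section Covariance

variable {Ω : Type*} {mΩ : MeasurableSpace Ω} {T : ℝ} {P : Measure Ω}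
  {H : Type*} [NormedAddCommGroup H] [InnerProductSpace ℝ H]
  {𝓕 : Filtration (Set.Icc (0 : ℝ) T) mΩ} {W : Set.Icc (0 : ℝ) T → H → Ω → ℝ}

namespace IsCylindricalWiener

theorem measurable (hW : IsCylindricalWiener P 𝓕 W) (t : Set.Icc (0 : ℝ) T) (v : H) :
    Measurable (W t v) :=
  (hW.adapted v t).mono (𝓕.le t) le_rfl

theorem measurable_increment (hW : IsCylindricalWiener P 𝓕 W) (s t : Set.Icc (0 : ℝ) T) (v : H) :
    Measurable fun ω => W t v ω - W s v ω :=
  (hW.measurable t v).sub (hW.measurable s v)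

theorem memLp_increment (hW : IsCylindricalWiener P 𝓕 W) {s t : Set.Icc (0 : ℝ) T} (hst : s ≤ t)
    (v : H) : MemLp (fun ω => W t v ω - W s v ω) 2 P := by
  have h := memLp_id_gaussianReal (μ := 0) (v := (((t : ℝ) - s) * ‖v‖ ^ 2).toNNReal) 2
  rw [← hW.law v s t hst, memLp_map_measure_iff aestronglyMeasurable_id
    (hW.measurable_increment s t v).aemeasurable] at h
  exact h

theorem integral_increment (hW : IsCylindricalWiener P 𝓕 W) {s t : Set.Icc (0 : ℝ) T}
    (hst : s ≤ t) (v : H) : ∫ ω, (W t v ω - W s v ω) ∂P = 0 := by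
  have h := integral_id_gaussianReal (μ := 0) (v := (((t : ℝ) - s) * ‖v‖ ^ 2).toNNReal)
  rwa [← hW.law v s t hst, integral_map
    (hW.measurable_increment s t v).aemeasurable (f := fun x => x) (by fun_prop)] at h

theorem integral_increment_sq (hW : IsCylindricalWiener P 𝓕 W) {s t : Set.Icc (0 : ℝ) T}
    (hst : s ≤ t) (v : H) :
    ∫ ω, (W t v ω - W s v ω) ^ 2 ∂P = ((t : ℝ) - s) * ‖v‖ ^ 2 := by
  have h := variance_id_gaussianReal (μ := 0) (v := (((t : ℝ) - s) * ‖v‖ ^ 2).toNNReal)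
  rw [variance_of_integral_eq_zero aemeasurable_id
    (by simp), ← hW.law v s t hst,
    integral_map (hW.measurable_increment s t v).aemeasurable (by fun_prop),
    Real.coe_toNNReal _ (mul_nonneg (sub_nonneg.2 hst) (sq_nonneg _))] at h
  exact h

theorem exists_time_zero (t : Set.Icc (0 : ℝ) T) : ∃ o : Set.Icc (0 : ℝ) T, (o : ℝ) = 0 ∧ o ≤ t :=
  ⟨⟨0, le_rfl, t.2.1.trans t.2.2⟩, rfl, t.2.1⟩

theorem memLp (hW : IsCylindricalWiener P 𝓕 W) (t : Set.Icc (0 : ℝ) T) (v : H) :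
    MemLp (W t v) 2 P := by
  obtain ⟨o, ho, hot⟩ := exists_time_zero t
  refine (memLp_congr_ae ?_).1 (hW.memLp_increment hot v)
  filter_upwards [hW.zero v o ho] with ω h
  rw [h, sub_zero]

theorem integral_sq (hW : IsCylindricalWiener P 𝓕 W) (t : Set.Icc (0 : ℝ) T) (v : H) :
    ∫ ω, W t v ω ^ 2 ∂P = t * ‖v‖ ^ 2 := by
  obtain ⟨o, ho, hot⟩ := exists_time_zero t
  have h := hW.integral_increment_sq hot v
  rw [ho, sub_zero] at h
  rw [← h]
  refine integral_congr_ae ?_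
  filter_upwards [hW.zero v o ho] with ω h
  rw [h, sub_zero]

theorem integrable_mul (hW : IsCylindricalWiener P 𝓕 W) (s t : Set.Icc (0 : ℝ) T) (v w : H) :
    Integrable (fun ω => W s v ω * W t w ω) P :=
  (hW.memLp s v).integrable_mul (hW.memLp t w)

/-- Polarization of `integral_sq`, by the almost sure linearity of `W t`. -/
theorem integral_mul_self_time (hW : IsCylindricalWiener P 𝓕 W) (t : Set.Icc (0 : ℝ) T)
    (v w : H) : ∫ ω, W t v ω * W t w ω ∂P = t * inner ℝ v w := by
  have h : ∫ ω, W t (v + w) ω ^ 2 ∂P =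
      ∫ ω, (W t v ω ^ 2 + W t w ω ^ 2 + 2 * (W t v ω * W t w ω)) ∂P := by
    refine integral_congr_ae ?_
    filter_upwards [hW.linear t 1 1 v w] with ω h
    rw [one_smul, one_smul] at h
    rw [h]; ring
  rw [integral_add (by exact (hW.memLp t v).integrable_sq.add (hW.memLp t w).integrable_sq)
    ((hW.integrable_mul t t v w).const_mul 2), integral_add (hW.memLp t v).integrable_sq
    (hW.memLp t w).integrable_sq, integral_const_mul, hW.integral_sq, hW.integral_sq,
    hW.integral_sq, norm_add_sq_real] at h
  linarith

/-- For `s ≤ t` the increment `W t w - W s w` is centered and independent of `W s v`, so only the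
part of `W t w` up to time `s` contributes to the covariance. -/
theorem integral_mul_of_le (hW : IsCylindricalWiener P 𝓕 W) {s t : Set.Icc (0 : ℝ) T}
    (hst : s ≤ t) (v w : H) : ∫ ω, W s v ω * W t w ω ∂P = s * inner ℝ v w := by
  have hind : IndepFun (W s v) (fun ω => W t w ω - W s w ω) P := by
    refine IndepFun.symm ((IndepFun_iff_Indep _ _ _).2 ?_)
    exact indep_of_indep_of_le_right (hW.indep w s t hst) (hW.adapted v s).comap_le
  have h0 : ∫ ω, W s v ω * (W t w ω - W s w ω) ∂P = 0 := by
    have := hind.integral_mul_eq_mul_integral (hW.measurable s v).aestronglyMeasurable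
      (hW.memLp_increment hst w).aestronglyMeasurable
    rw [hW.integral_increment hst, mul_zero] at this
    exact this
  simp only [mul_sub] at h0
  rw [integral_sub (hW.integrable_mul s t v w) (hW.integrable_mul s s v w),
    hW.integral_mul_self_time] at h0
  linarith

theorem integral_mul (hW : IsCylindricalWiener P 𝓕 W) (s t : Set.Icc (0 : ℝ) T) (v w : H) :
    ∫ ω, W s v ω * W t w ω ∂P = min (s : ℝ) t * inner ℝ v w := by
  rcases le_total s t with h | h
  · rw [hW.integral_mul_of_le h, min_eq_left (Subtype.coe_le_coe.2 h)]
  · simp_rw [mul_comm (W s v _)]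
    rw [hW.integral_mul_of_le h, min_eq_right (Subtype.coe_le_coe.2 h), real_inner_comm]

end IsCylindricalWiener

theorem integral_sub_sub_add {α : Type*} {mα : MeasurableSpace α} {μ : Measure α}
    {f g h k : α → ℝ} (hf : Integrable f μ) (hg : Integrable g μ) (hh : Integrable h μ)
    (hk : Integrable k μ) :
    ∫ a, (f a - g a - h a + k a) ∂μ = ∫ a, f a ∂μ - ∫ a, g a ∂μ - ∫ a, h a ∂μ + ∫ a, k a ∂μ := by
  change ∫ a, (f - g - h + k) a ∂μ = _
  rw [integral_add' ((hf.sub hg).sub hh) hk, integral_sub' (hf.sub hg) hh, integral_sub' hf hg]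

/-- The length of `(s, t] ∩ (s', t']` in terms of the covariance `min` of Brownian motion. -/
def overlap (s t s' t' : ℝ) : ℝ := min t t' - min t s' - min s t' + min s s'

theorem IsCylindricalWiener.integral_increment_mul (hW : IsCylindricalWiener P 𝓕 W)
    (s t s' t' : Set.Icc (0 : ℝ) T) (v w : H) :
    ∫ ω, (W t v ω - W s v ω) * (W t' w ω - W s' w ω) ∂P = overlap s t s' t' * inner ℝ v w := by
  have h : ∀ ω, (W t v ω - W s v ω) * (W t' w ω - W s' w ω) = W t v ω * W t' w ω
      - W t v ω * W s' w ω - W s v ω * W t' w ω + W s v ω * W s' w ω := fun ω => by ring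
  have i1 := hW.integrable_mul t t' v w
  have i2 := hW.integrable_mul t s' v w
  have i3 := hW.integrable_mul s t' v w
  have i4 := hW.integrable_mul s s' v w
  simp_rw [h]
  rw [integral_sub_sub_add i1 i2 i3 i4,
    hW.integral_mul, hW.integral_mul, hW.integral_mul, hW.integral_mul, overlap]
  ring

/-- The indicator function of `(s, t]`. -/
def stepInd (s t r : ℝ) : ℝ := (Set.Ioc s t).indicator 1 r

theorem stepInd_eq_sub {s t r : ℝ} (hs : 0 ≤ s) (hst : s ≤ t) :
    stepInd s t r = stepInd 0 t r - stepInd 0 s r := by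
  simp only [stepInd, Set.indicator_apply, Set.mem_Ioc, Pi.one_apply]
  split_ifs <;> grind

theorem stepInd_mul (s t r : ℝ) : stepInd 0 s r * stepInd 0 t r = stepInd 0 (min s t) r := by
  simp only [stepInd, Set.indicator_apply, Set.mem_Ioc, Pi.one_apply, le_min_iff]
  split_ifs <;> grind

theorem measurable_stepInd (s t : ℝ) : Measurable (stepInd s t) :=
  measurable_one.indicator measurableSet_Ioc

theorem integrableOn_stepInd (s t : ℝ) : IntegrableOn (stepInd s t) (Set.Icc 0 T) :=
  (integrable_const (1 : ℝ)).indicator measurableSet_Ioc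

theorem integral_stepInd {t : ℝ} (ht : t ∈ Set.Icc 0 T) :
    ∫ r in Set.Icc 0 T, stepInd 0 t r = t := by
  unfold stepInd
  rw [integral_indicator_one measurableSet_Ioc, measureReal_restrict_apply measurableSet_Ioc,
    Set.inter_eq_left.2 (show Set.Ioc 0 t ⊆ Set.Icc 0 T from
      fun x hx => ⟨hx.1.le, hx.2.trans ht.2⟩), Real.volume_real_Ioc_of_le ht.1,
    sub_zero]

theorem stepInd_mul_eq {s t s' t' : Set.Icc (0 : ℝ) T} (h : s ≤ t) (h' : s' ≤ t') (r : ℝ) :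
    stepInd s t r * stepInd s' t' r = stepInd 0 (min (t : ℝ) t') r - stepInd 0 (min (t : ℝ) s') r
      - stepInd 0 (min (s : ℝ) t') r + stepInd 0 (min (s : ℝ) s') r := by
  rw [stepInd_eq_sub s.2.1 h, stepInd_eq_sub s'.2.1 h']
  simp only [← stepInd_mul]
  ring

theorem integrableOn_stepInd_mul {s t s' t' : Set.Icc (0 : ℝ) T} (h : s ≤ t) (h' : s' ≤ t') :
    IntegrableOn (fun r => stepInd s t r * stepInd s' t' r) (Set.Icc 0 T) := by
  simp_rw [stepInd_mul_eq h h']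
  exact (((integrableOn_stepInd _ _).sub (integrableOn_stepInd _ _)).sub
    (integrableOn_stepInd _ _)).add (integrableOn_stepInd _ _)

theorem integral_stepInd_mul {s t s' t' : Set.Icc (0 : ℝ) T} (h : s ≤ t) (h' : s' ≤ t') :
    ∫ r in Set.Icc 0 T, stepInd s t r * stepInd s' t' r = overlap s t s' t' := by
  have hi := fun a : ℝ => integrableOn_stepInd (T := T) 0 a
  have hm : ∀ a c : Set.Icc (0 : ℝ) T, min (a : ℝ) c ∈ Set.Icc (0 : ℝ) T := fun a c =>
    ⟨le_min a.2.1 c.2.1, (min_le_left _ _).trans a.2.2⟩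
  simp_rw [stepInd_mul_eq h h']
  rw [integral_sub_sub_add (hi _) (hi _) (hi _) (hi _), integral_stepInd (hm _ _), integral_stepInd (hm _ _),
    integral_stepInd (hm _ _), integral_stepInd (hm _ _), overlap]

end Covariance

/-! ### Itô's isometry for elementary integrands -/

section Elementary

variable {Ω : Type*} {mΩ : MeasurableSpace Ω} {T : ℝ} {P : Measure Ω}
  {H : Type*} [NormedAddCommGroup H] [InnerProductSpace ℝ H]
  {𝓕 : Filtration (Set.Icc (0 : ℝ) T) mΩ} {W : Set.Icc (0 : ℝ) T → H → Ω → ℝ}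
  {E : Type*} [NormedAddCommGroup E] [InnerProductSpace ℝ E]
  {ι : Type*} (b : HilbertBasis ι ℝ H)

theorem norm_sq_sum_smul {κ : Type*} [Fintype κ] (c : κ → ℝ) (u : κ → E) :
    ‖∑ j, c j • u j‖ ^ 2 = ∑ j, ∑ k, c j * c k * inner ℝ (u j) (u k) := by
  rw [← real_inner_self_eq_norm_sq, sum_inner]
  refine Finset.sum_congr rfl fun j _ => ?_
  rw [inner_sum]
  refine Finset.sum_congr rfl fun k _ => ?_
  rw [real_inner_smul_left, real_inner_smul_right, mul_assoc]

theorem enorm_sq_eq_ofReal {F : Type*} [NormedAddCommGroup F] (x : F) : ‖x‖ₑ ^ 2 = ENNReal.ofReal (‖x‖ ^ 2) := by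
  rw [← ofReal_norm, ENNReal.ofReal_pow (norm_nonneg _)]

/-- The Gram sum that expresses the second moment of a family of increments of a Wiener process,
and also the squared norm of the corresponding step function in `L²([0, T]; HS(H, E))`. -/
def ElementaryIntegrand.gram (Ψ : ElementaryIntegrand T H E) : ℝ :=
  ∑ j, ∑ k, overlap (Ψ.s j) (Ψ.t j) (Ψ.s k) (Ψ.t k) * inner ℝ (Ψ.a j) (Ψ.a k) *
    inner ℝ (Ψ.u j) (Ψ.u k)

theorem ElementaryIntegrand.stronglyMeasurable_integral (Ψ : ElementaryIntegrand T H E)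
    (hW : IsCylindricalWiener P 𝓕 W) : StronglyMeasurable (Ψ.integral W) := by
  refine Finset.stronglyMeasurable_fun_sum _ fun j _ => ?_
  exact ((hW.measurable _ _).sub (hW.measurable _ _)).stronglyMeasurable.smul_const _

theorem ElementaryIntegrand.lintegral_integral (Ψ : ElementaryIntegrand T H E)
    (hW : IsCylindricalWiener P 𝓕 W) :
    ∫⁻ ω, ‖Ψ.integral W ω‖ₑ ^ 2 ∂P = ENNReal.ofReal Ψ.gram := by
  have hi : ∀ j k, Integrable (fun ω => (W (Ψ.t j) (Ψ.a j) ω - W (Ψ.s j) (Ψ.a j) ω) *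
      (W (Ψ.t k) (Ψ.a k) ω - W (Ψ.s k) (Ψ.a k) ω) * inner ℝ (Ψ.u j) (Ψ.u k)) P := fun j k =>
    ((hW.memLp_increment (Ψ.le j) _).integrable_mul (hW.memLp_increment (Ψ.le k) _)).mul_const _
  simp_rw [enorm_sq_eq_ofReal]
  rw [← ofReal_integral_eq_lintegral_ofReal _ (.of_forall fun ω => sq_nonneg _)]
  · congr 1
    unfold ElementaryIntegrand.integral
    simp_rw [norm_sq_sum_smul]
    rw [integral_finsetSum _ fun j _ => integrable_finsetSum _ fun k _ => hi j k]
    refine Finset.sum_congr rfl fun j _ => ?_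
    rw [integral_finsetSum _ fun k _ => hi j k]
    refine Finset.sum_congr rfl fun k _ => ?_
    rw [integral_mul_const, hW.integral_increment_mul]
  · unfold ElementaryIntegrand.integral
    simp_rw [norm_sq_sum_smul]
    exact integrable_finsetSum _ fun j _ => integrable_finsetSum _ fun k _ => hi j k

/-- Parseval's identity for the squared Hilbert-Schmidt norm of a finite rank operator. -/
theorem hasSum_norm_sq_sum_smul {κ : Type*} [Fintype κ] (c : κ → ℝ) (a : κ → H) (u : κ → E) :
    HasSum (fun i => ‖(∑ j, c j • (innerSL ℝ (a j)).smulRight (u j)) (b i)‖ ^ 2)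
      (∑ j, ∑ k, c j * c k * inner ℝ (a j) (a k) * inner ℝ (u j) (u k)) := by
  have h : ∀ i, ‖(∑ j, c j • (innerSL ℝ (a j)).smulRight (u j)) (b i)‖ ^ 2 =
      ∑ j, ∑ k, c j * c k * inner ℝ (u j) (u k) * (inner ℝ (a j) (b i) * inner ℝ (b i) (a k)) := by
    intro i
    have : (∑ j, c j • (innerSL ℝ (a j)).smulRight (u j)) (b i) =
        ∑ j, (c j * inner ℝ (a j) (b i)) • u j := by
      simp [mul_smul]
    rw [this, norm_sq_sum_smul]
    refine Finset.sum_congr rfl fun j _ => Finset.sum_congr rfl fun k _ => ?_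
    rw [real_inner_comm (a k) (b i)]
    ring
  simp_rw [h]
  refine hasSum_sum fun j _ => hasSum_sum fun k _ => ?_
  rw [mul_right_comm _ (inner ℝ (a j) (a k))]
  exact (b.hasSum_inner_mul_inner (a j) (a k)).mul_left _

theorem hsNormSq_sum_smul {κ : Type*} [Fintype κ] (c : κ → ℝ) (a : κ → H) (u : κ → E) :
    hsNormSq b (∑ j, c j • (innerSL ℝ (a j)).smulRight (u j)) =
      ENNReal.ofReal (∑ j, ∑ k, c j * c k * inner ℝ (a j) (a k) * inner ℝ (u j) (u k)) := by
  have hs := hasSum_norm_sq_sum_smul b c a u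
  unfold hsNormSq
  simp_rw [enorm_sq_eq_ofReal]
  rw [← ENNReal.ofReal_tsum_of_nonneg (fun i => sq_nonneg _) hs.summable, hs.tsum_eq]

theorem ElementaryIntegrand.hsNormSq_toFun (Ψ : ElementaryIntegrand T H E) (r : ℝ) :
    hsNormSq b (Ψ.toFun r) = ENNReal.ofReal (∑ j, ∑ k,
      stepInd (Ψ.s j) (Ψ.t j) r * stepInd (Ψ.s k) (Ψ.t k) r * inner ℝ (Ψ.a j) (Ψ.a k) *
        inner ℝ (Ψ.u j) (Ψ.u k)) := by
  rw [← hsNormSq_sum_smul]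
  congr 1
  refine Finset.sum_congr rfl fun j _ => ?_
  by_cases h : r ∈ Set.Ioc (Ψ.s j : ℝ) (Ψ.t j) <;> simp [stepInd, h]

theorem ElementaryIntegrand.measurable_hsNormSq (Ψ : ElementaryIntegrand T H E) :
    Measurable fun r => hsNormSq b (Ψ.toFun r) := by
  simp_rw [Ψ.hsNormSq_toFun b]
  refine (Finset.measurable_fun_sum _ fun j _ => Finset.measurable_fun_sum _ fun k _ => ?_).ennreal_ofReal
  exact (((measurable_stepInd _ _).mul (measurable_stepInd _ _)).mul_const _).mul_const _

theorem ElementaryIntegrand.lintegral_hsNormSq (Ψ : ElementaryIntegrand T H E) :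
    ∫⁻ r in Set.Icc 0 T, hsNormSq b (Ψ.toFun r) = ENNReal.ofReal Ψ.gram := by
  have hi : ∀ j k, IntegrableOn (fun r => stepInd (Ψ.s j) (Ψ.t j) r * stepInd (Ψ.s k) (Ψ.t k) r *
      inner ℝ (Ψ.a j) (Ψ.a k) * inner ℝ (Ψ.u j) (Ψ.u k)) (Set.Icc 0 T) := fun j k =>
    ((integrableOn_stepInd_mul (Ψ.le j) (Ψ.le k)).mul_const _).mul_const _
  -- by Parseval the double sum is a squared Hilbert-Schmidt norm, hence nonnegative
  have hnn : ∀ r, 0 ≤ ∑ j, ∑ k, stepInd (Ψ.s j) (Ψ.t j) r * stepInd (Ψ.s k) (Ψ.t k) r *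
      inner ℝ (Ψ.a j) (Ψ.a k) * inner ℝ (Ψ.u j) (Ψ.u k) := fun r =>
    (hasSum_norm_sq_sum_smul b (fun j => stepInd (Ψ.s j) (Ψ.t j) r) Ψ.a Ψ.u).nonneg
      fun i => sq_nonneg _
  simp_rw [Ψ.hsNormSq_toFun b]
  rw [← ofReal_integral_eq_lintegral_ofReal _ (.of_forall hnn)]
  · congr 1
    rw [integral_finsetSum _ fun j _ => integrable_finsetSum _ fun k _ => hi j k]
    refine Finset.sum_congr rfl fun j _ => ?_
    rw [integral_finsetSum _ fun k _ => hi j k]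
    refine Finset.sum_congr rfl fun k _ => ?_
    rw [integral_mul_const, integral_mul_const, integral_stepInd_mul (Ψ.le j) (Ψ.le k)]
  · exact integrable_finsetSum _ fun j _ => integrable_finsetSum _ fun k _ => hi j k

/-- Itô's isometry for elementary integrands. -/
theorem ElementaryIntegrand.ito_isometry (Ψ : ElementaryIntegrand T H E)
    (hW : IsCylindricalWiener P 𝓕 W) :
    ∫⁻ ω, ‖Ψ.integral W ω‖ₑ ^ 2 ∂P = ∫⁻ r in Set.Icc 0 T, hsNormSq b (Ψ.toFun r) := by
  rw [Ψ.lintegral_integral hW, Ψ.lintegral_hsNormSq b]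

end Elementary

/-! ### Itô's isometry for deterministic integrands -/

section Ito

/-- Young's inequality for the square of a sum. Unlike the triangle inequality for `L²` norms, it
can be summed and integrated term by term. -/
theorem enorm_add_sq_le {F : Type*} [NormedAddCommGroup F] {δ : ℝ≥0} (hδ : 0 < δ) (x y : F) :
    ‖x + y‖ₑ ^ 2 ≤ (1 + δ : ℝ≥0) * ‖x‖ₑ ^ 2 + (1 + δ⁻¹ : ℝ≥0) * ‖y‖ₑ ^ 2 := by
  simp only [enorm_eq_nnnorm, ← ENNReal.coe_pow, ← ENNReal.coe_mul, ← ENNReal.coe_add,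
    ENNReal.coe_le_coe]
  refine (pow_le_pow_left₀ zero_le (nnnorm_add_le x y) 2).trans ?_
  rw [← NNReal.coe_le_coe]
  push_cast
  have h : (0 : ℝ) < δ := hδ
  have key : 0 ≤ (δ : ℝ)⁻¹ * (δ * ‖x‖ - ‖y‖) ^ 2 := by positivity
  have : (δ : ℝ)⁻¹ * (δ * ‖x‖ - ‖y‖) ^ 2 = δ * ‖x‖ ^ 2 - 2 * ‖x‖ * ‖y‖ + (δ : ℝ)⁻¹ * ‖y‖ ^ 2 := by
    field_simp; ring
  linarith

variable {H : Type*} [NormedAddCommGroup H] [InnerProductSpace ℝ H]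
  {E : Type*} [NormedAddCommGroup E] [NormedSpace ℝ E] {ι : Type*} (b : HilbertBasis ι ℝ H)

theorem hsNormSq_add_le {δ : ℝ≥0} (hδ : 0 < δ) (K L : H →L[ℝ] E) :
    hsNormSq b (K + L) ≤
      (1 + δ : ℝ≥0) * hsNormSq b K + (1 + δ⁻¹ : ℝ≥0) * hsNormSq b L := by
  unfold hsNormSq
  rw [← ENNReal.tsum_mul_left, ← ENNReal.tsum_mul_left, ← ENNReal.tsum_add]
  exact ENNReal.tsum_le_tsum fun i => enorm_add_sq_le hδ _ _

theorem hsNormSq_neg (L : H →L[ℝ] E) : hsNormSq b (-L) = hsNormSq b L := by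
  simp [hsNormSq]

theorem lintegral_le_add_of_le {α : Type*} {mα : MeasurableSpace α} {μ : Measure α}
    {f g h : α → ℝ≥0∞} {C D : ℝ≥0} (hg : AEMeasurable g μ) (hle : ∀ x, f x ≤ C * g x + D * h x) :
    ∫⁻ x, f x ∂μ ≤ C * ∫⁻ x, g x ∂μ + D * ∫⁻ x, h x ∂μ := by
  refine (lintegral_mono hle).trans (le_of_eq ?_)
  rw [lintegral_add_left' (hg.const_mul _), lintegral_const_mul' _ _ ENNReal.coe_ne_top,
    lintegral_const_mul' _ _ ENNReal.coe_ne_top]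

/-- A comparison of the squares of two norms by means of approximations: `x k` is the square of
the norm of the `k`-th approximation, `d k` and `d' k` are the squares of the errors. -/
theorem le_of_approx {a g : ℝ≥0∞} {x d d' : ℕ → ℝ≥0∞} (hd : Tendsto d atTop (𝓝 0))
    (hd' : Tendsto d' atTop (𝓝 0))
    (h : ∀ δ : ℝ≥0, 0 < δ → ∀ k, a ≤ (1 + δ : ℝ≥0) * x k + (1 + δ⁻¹ : ℝ≥0) * d k)
    (h' : ∀ δ : ℝ≥0, 0 < δ → ∀ k, x k ≤ (1 + δ : ℝ≥0) * g + (1 + δ⁻¹ : ℝ≥0) * d' k) : a ≤ g := by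
  rcases eq_or_ne g ⊤ with rfl | hg
  · exact le_top
  have h1 : ∀ δ : ℝ≥0, 0 < δ → a ≤ ((1 + δ) * (1 + δ) : ℝ≥0) * g := by
    intro δ hδ
    have hlim : Tendsto (fun k => ((1 + δ : ℝ≥0) : ℝ≥0∞) * ((1 + δ : ℝ≥0) * g +
        (1 + δ⁻¹ : ℝ≥0) * d' k) + (1 + δ⁻¹ : ℝ≥0) * d k) atTop
        (𝓝 (((1 + δ : ℝ≥0) : ℝ≥0∞) * ((1 + δ : ℝ≥0) * g + (1 + δ⁻¹ : ℝ≥0) * 0) +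
          (1 + δ⁻¹ : ℝ≥0) * 0)) := by
      refine Tendsto.add (ENNReal.Tendsto.const_mul (tendsto_const_nhds.add
        (ENNReal.Tendsto.const_mul hd' (.inr ENNReal.coe_ne_top))) (.inr ENNReal.coe_ne_top))
        (ENNReal.Tendsto.const_mul hd (.inr ENNReal.coe_ne_top))
    rw [mul_zero, add_zero, add_zero, ← mul_assoc, ← ENNReal.coe_mul] at hlim
    refine ge_of_tendsto' hlim fun k => (h δ hδ k).trans ?_
    gcongr
    exact h' δ hδ k
  have hlim : Tendsto (fun δ : ℝ≥0 => (((1 + δ) * (1 + δ) : ℝ≥0) : ℝ≥0∞) * g) (𝓝[>] 0)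
      (𝓝 ((((1 + 0) * (1 + 0) : ℝ≥0) : ℝ≥0∞) * g)) := by
    refine ENNReal.Tendsto.mul_const (ENNReal.tendsto_coe.2 ?_) (.inr hg)
    have : Continuous fun δ : ℝ≥0 => (1 + δ) * (1 + δ) := by fun_prop
    exact (this.tendsto 0).mono_left nhdsWithin_le_nhds
  rw [add_zero, one_mul, ENNReal.coe_one, one_mul] at hlim
  refine ge_of_tendsto hlim ?_
  filter_upwards [self_mem_nhdsWithin] with δ hδ using h1 δ hδ

theorem lintegral_enorm_sq {Ω : Type*} {mΩ : MeasurableSpace Ω} {P : Measure Ω} {F : Type*}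
    [NormedAddCommGroup F] (f : Ω → F) :
    ∫⁻ ω, ‖f ω‖ₑ ^ 2 ∂P = eLpNorm f 2 P ^ 2 := by
  have := eLpNorm_nnreal_pow_eq_lintegral (f := f) (μ := P) (p := 2) two_ne_zero
  simpa using this.symm

end Ito

section Isometry

variable {Ω : Type*} {mΩ : MeasurableSpace Ω} {T : ℝ} {P : Measure Ω}
  {H : Type*} [NormedAddCommGroup H] [InnerProductSpace ℝ H]
  {𝓕 : Filtration (Set.Icc (0 : ℝ) T) mΩ} {W : Set.Icc (0 : ℝ) T → H → Ω → ℝ}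
  {E : Type*} [NormedAddCommGroup E] [InnerProductSpace ℝ E]
  {ι : Type*} {b : HilbertBasis ι ℝ H}

/-- Itô's isometry: the second moment of `∫_0^T Φ_s dW_s` is the squared norm of `Φ` in
`L²([0, T]; HS(H, E))`. -/
theorem IsStochasticIntegral.ito_isometry {Φ : ℝ → H →L[ℝ] E} {X : Ω → E}
    (hW : IsCylindricalWiener P 𝓕 W) (hX : IsStochasticIntegral P W b Φ X)
    (hΦ : AEMeasurable (fun r => hsNormSq b (Φ r)) (volume.restrict (Set.Icc 0 T))) :
    ∫⁻ ω, ‖X ω‖ₑ ^ 2 ∂P = ∫⁻ r in Set.Icc 0 T, hsNormSq b (Φ r) := by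
  obtain ⟨hXm, Ψ, hΨ, hΨX⟩ := hX
  have hdX : Tendsto (fun k => ∫⁻ ω, ‖X ω - (Ψ k).integral W ω‖ₑ ^ 2 ∂P) atTop (𝓝 0) := by
    simp_rw [lintegral_enorm_sq]
    simpa using ENNReal.Tendsto.pow (n := 2) hΨX
  refine le_antisymm ?_ ?_
  · refine le_of_approx (x := fun k => ∫⁻ ω, ‖(Ψ k).integral W ω‖ₑ ^ 2 ∂P) hdX hΨ ?_ ?_
    · intro δ hδ k
      refine lintegral_le_add_of_le
        (((Ψ k).stronglyMeasurable_integral hW).enorm.pow_const 2).aemeasurable fun ω => ?_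
      simpa using enorm_add_sq_le hδ ((Ψ k).integral W ω) (X ω - (Ψ k).integral W ω)
    · intro δ hδ k
      rw [(Ψ k).ito_isometry b hW]
      refine lintegral_le_add_of_le hΦ fun r => ?_
      simpa using hsNormSq_add_le b hδ (Φ r) ((Ψ k).toFun r - Φ r)
  · refine le_of_approx (x := fun k => ∫⁻ ω, ‖(Ψ k).integral W ω‖ₑ ^ 2 ∂P) hΨ hdX ?_ ?_
    · intro δ hδ k
      rw [(Ψ k).ito_isometry b hW]
      refine lintegral_le_add_of_le ((Ψ k).measurable_hsNormSq b).aemeasurable fun r => ?_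
      have := hsNormSq_add_le b hδ ((Ψ k).toFun r) (-((Ψ k).toFun r - Φ r))
      rw [hsNormSq_neg] at this
      simpa using this
    · intro δ hδ k
      refine lintegral_le_add_of_le (hXm.enorm.pow_const 2) fun ω => ?_
      have := enorm_add_sq_le hδ (X ω) (-(X ω - (Ψ k).integral W ω))
      rw [enorm_neg] at this
      simpa using this

theorem memLp_two_of_lintegral {F : Type*} [NormedAddCommGroup F] {X : Ω → F} (hX : AEStronglyMeasurable X P)
    (h : ∫⁻ ω, ‖X ω‖ₑ ^ 2 ∂P ≠ ⊤) : MemLp X 2 P := by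
  rw [lintegral_enorm_sq] at h
  exact ⟨hX, lt_top_iff_ne_top.2 fun h' => h (by rw [h']; rfl)⟩

theorem integral_norm_sq_of_lintegral {F : Type*} [NormedAddCommGroup F] {X : Ω → F}
    (hX : AEStronglyMeasurable X P) {a : ℝ} (ha : 0 ≤ a) (h : ∫⁻ ω, ‖X ω‖ₑ ^ 2 ∂P = ENNReal.ofReal a) : ∫ ω, ‖X ω‖ ^ 2 ∂P = a := by
  rw [integral_eq_lintegral_of_nonneg_ae (.of_forall fun ω => sq_nonneg _) (hX.norm.pow 2)]
  simp_rw [← enorm_sq_eq_ofReal]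
  rw [h, ENNReal.toReal_ofReal ha]

end Isometry

/-! ### The second moment of the stochastic wave equation -/

namespace NegEigenvalues

open InterpSpace

variable {ι : Type*} (Λ : NegEigenvalues ι)
  {H : Type*} [NormedAddCommGroup H] [InnerProductSpace ℝ H]
  (b : HilbertBasis ι ℝ H) (m : ι → ℝ) (hm : Summable fun i => |m i| ^ 2 / |Λ.val i|)

theorem coeff_snd_waveProj_noiseOp [DecidableEq ι] (I : Set ι) (i j : ι) :
    coeff (Λ.waveProj I (Λ.noiseOp b m hm (b i))).snd j =
      I.indicator (fun k => if k = i then m i else 0) j := by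
  change I.indicator (fun k => m k * inner ℝ (b k) (b i)) j = _
  congr 1
  ext k
  rw [orthonormal_iff_ite.1 b.orthonormal]
  split_ifs with h
  · rw [h, mul_one]
  · rw [mul_zero]

theorem coeff_fst_waveProj_noiseOp (I : Set ι) (v : H) :
    coeff (Λ.waveProj I (Λ.noiseOp b m hm v)).fst = 0 := by
  change I.indicator (coeff (0 : Λ.InterpSpace 0)) = 0
  simp

theorem waveProj_noiseOp_mem_domain (I : Set ι) (i : ι) :
    Λ.waveProj I (Λ.noiseOp b m hm (b i)) ∈ Λ.waveDomain := by
  classical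
  refine ⟨?_, ?_⟩
  · rw [coeff_fst_waveProj_noiseOp]; exact Submodule.zero_mem _
  · rw [mem_interp_zero_iff]
    refine summable_of_ne_finset_zero (s := {i}) fun j hj => ?_
    rw [coeff_snd_waveProj_noiseOp]
    simp [Finset.mem_singleton.not.1 hj, Set.indicator_apply]

theorem norm_sq_waveProj_noiseOp (I : Set ι) (i : ι) :
    ‖Λ.waveProj I (Λ.noiseOp b m hm (b i))‖ ^ 2 =
      I.indicator (fun i => |m i| ^ 2 / |Λ.val i|) i := by
  classical
  rw [WithLp.prod_norm_sq_eq_of_L2, norm_sq_eq, norm_sq_eq, coeff_fst_waveProj_noiseOp]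
  simp only [coeff_snd_waveProj_noiseOp, weight_neg_half, Pi.zero_apply, mul_zero, ne_eq,
    OfNat.ofNat_ne_zero, not_false_eq_true, zero_pow, tsum_zero, zero_add]
  rw [tsum_eq_single i fun j hj => by simp [hj, Set.indicator_apply]]
  by_cases hi : i ∈ I
  · simp [hi, mul_pow, freq_sq, div_eq_inv_mul]
  · simp [hi]

/-- The integrand of the stochastic wave equation has constant Hilbert-Schmidt norm, because the
wave semigroup is isometric. -/
theorem hsNormSq_integrand (I : Set ι) {t : ℝ} (ht : 0 ≤ t) :
    hsNormSq b (expSemigroup Λ.waveOp t ∘L Λ.waveProj I ∘L Λ.noiseOp b m hm) =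
      ENNReal.ofReal (∑' i, I.indicator (fun i => |m i| ^ 2 / |Λ.val i|) i) := by
  unfold hsNormSq
  rw [ENNReal.ofReal_tsum_of_nonneg (fun i => Set.indicator_nonneg (fun i _ => by positivity) i)
    (hm.indicator I)]
  refine tsum_congr fun i => ?_
  rw [enorm_sq_eq_ofReal, ContinuousLinearMap.comp_apply, ContinuousLinearMap.comp_apply,
    Λ.norm_expSemigroup_waveOp (Λ.waveProj_noiseOp_mem_domain b m hm I i) ht,
    norm_sq_waveProj_noiseOp]

variable {T : ℝ} {Ω : Type*} {mΩ : MeasurableSpace Ω} {P : Measure Ω}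
  {𝓕 : Filtration (Set.Icc (0 : ℝ) T) mΩ} {W : Set.Icc (0 : ℝ) T → H → Ω → ℝ}

/-- The second moment of the (projected) solution of the stochastic wave equation. -/
theorem second_moment (hT : 0 ≤ T) (hW : IsCylindricalWiener P 𝓕 W) (I : Set ι)
    {X : Ω → Λ.WaveSpace}
    (hX : IsStochasticIntegral P W b
      (fun s => expSemigroup Λ.waveOp (T - s) ∘L Λ.waveProj I ∘L Λ.noiseOp b m hm) X) :
    MemLp X 2 P ∧
      ∫ ω, ‖X ω‖ ^ 2 ∂P = T * ∑' i, I.indicator (fun i => |m i| ^ 2 / |Λ.val i|) i := by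
  set K := ∑' i, I.indicator (fun i => |m i| ^ 2 / |Λ.val i|) i with hK
  have hK0 : 0 ≤ K := tsum_nonneg fun i => Set.indicator_nonneg (fun i _ => by positivity) i
  have hc : (fun r => hsNormSq b
      (expSemigroup Λ.waveOp (T - r) ∘L Λ.waveProj I ∘L Λ.noiseOp b m hm))
      =ᵐ[volume.restrict (Set.Icc 0 T)] fun _ => ENNReal.ofReal K := by
    filter_upwards [ae_restrict_mem measurableSet_Icc] with r hr
    exact Λ.hsNormSq_integrand b m hm I (sub_nonneg.2 hr.2)
  have h := hX.ito_isometry hW (aemeasurable_const.congr hc.symm)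
  rw [lintegral_congr_ae hc, lintegral_const, Measure.restrict_apply_univ, Real.volume_Icc,
    sub_zero, mul_comm, ← ENNReal.ofReal_mul hT] at h
  exact ⟨memLp_two_of_lintegral hX.1 (by rw [h]; exact ENNReal.ofReal_ne_top),
    integral_norm_sq_of_lintegral hX.1 (mul_nonneg hT hK0) h⟩

end NegEigenvalues

/-! ### The tail of the series `∑ n ^ (-p)` -/

section Tail

theorem one_sub_mul_le_one_add_rpow_neg {q x : ℝ} (hq : 0 ≤ q) (hx : 0 ≤ x) :
    1 - q * x ≤ (1 + x) ^ (-q) := by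
  calc 1 - q * x = -q * x + 1 := by ring
    _ ≤ Real.exp (-q * x) := Real.add_one_le_exp _
    _ = Real.exp x ^ (-q) := by rw [← Real.exp_mul, mul_comm]
    _ ≤ (1 + x) ^ (-q) :=
        Real.rpow_le_rpow_of_nonpos (by linarith) (by linarith [Real.add_one_le_exp x])
          (by linarith)

/-- The estimate `x ^ (-p) ≥ ∫_x^{x+1} y ^ (-p) dy`, multiplied by `p - 1`. -/
theorem rpow_telescope_le {x p : ℝ} (hx : 0 < x) (hp : 1 ≤ p) :
    x ^ (1 - p) - (x + 1) ^ (1 - p) ≤ (p - 1) * x ^ (-p) := by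
  have h := one_sub_mul_le_one_add_rpow_neg (q := p - 1) (sub_nonneg.2 hp) (inv_pos.2 hx).le
  have h1 : x + 1 = x * (1 + x⁻¹) := by field_simp
  have h2 : x ^ (-p) = x ^ (1 - p) * x⁻¹ := by
    rw [← Real.rpow_neg_one x, ← Real.rpow_add hx]; congr 1; ring
  rw [h1, Real.mul_rpow hx.le (by positivity), h2]
  rw [neg_sub] at h
  have := mul_le_mul_of_nonneg_left h (Real.rpow_nonneg hx.le (1 - p))
  linarith

theorem rpow_le_tsum_tail {p : ℝ} (hp : 1 < p) (N : ℕ) :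
    ((N : ℝ) + 1) ^ (1 - p) ≤ (p - 1) * ∑' k : ℕ, ((N : ℝ) + 1 + k) ^ (-p) := by
  have hs : Summable fun k : ℕ => ((N : ℝ) + 1 + k) ^ (-p) := by
    have := (summable_nat_add_iff (N + 1)).2 (Real.summable_nat_rpow.2 (neg_lt_neg hp))
    refine this.congr fun k => ?_
    push_cast
    congr 1
    ring
  have hlim : Tendsto (fun n : ℕ => ((N : ℝ) + 1 + n) ^ (1 - p)) atTop (𝓝 0) := by
    have h1 : Tendsto (fun n : ℕ => (N : ℝ) + 1 + n) atTop atTop :=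
      tendsto_atTop_add_const_left _ _ tendsto_natCast_atTop_atTop
    have h2 := (tendsto_rpow_neg_atTop (sub_pos.2 hp)).comp h1
    simpa only [neg_sub, Function.comp_def] using h2
  have htel : Tendsto (fun n : ℕ => ((N : ℝ) + 1) ^ (1 - p) - ((N : ℝ) + 1 + n) ^ (1 - p)) atTop
      (𝓝 (((N : ℝ) + 1) ^ (1 - p))) := by
    simpa using hlim.const_sub (((N : ℝ) + 1) ^ (1 - p))
  refine le_of_tendsto_of_tendsto' htel ((hs.hasSum.mul_left (p - 1)).tendsto_sum_nat) fun n => ?_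
  induction n with
  | zero => simp
  | succ n ih =>
    rw [Finset.sum_range_succ]
    have := rpow_telescope_le (x := (N : ℝ) + 1 + n) (by positivity) hp.le
    push_cast
    rw [← add_assoc]
    linarith

/-- If `f n` is at least `a n ^ (-p)` along an enumeration, then the tail of the series of `f` past
`N` is at least a multiple of `N ^ (1 - p)`. -/
theorem le_tsum_sub_tsum_indicator {ι : Type*} {f : ι → ℝ} (hf : Summable f)
    (hf0 : ∀ i, 0 ≤ f i) {e : ℕ+ → ι} (he : Function.Injective e) {a p : ℝ} (ha : 0 ≤ a)
    (hp : 1 < p) (hle : ∀ n : ℕ+, a * (n : ℝ) ^ (-p) ≤ f (e n)) (N : ℕ+) :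
    a * (N : ℝ) ^ (1 - p) / ((p - 1) * 2 ^ (p - 1)) ≤
      ∑' i, f i - ∑' i, (e '' Set.Iic N).indicator f i := by
  have hp1 : 0 < p - 1 := sub_pos.2 hp
  have hN1 : (1 : ℝ) ≤ N := by exact_mod_cast N.pos
  have hN0 : (0 : ℝ) < N := by linarith
  -- the difference of the two sums is the sum over the complement of `e '' Set.Iic N`
  have hcompl : ∑' i, f i - ∑' i, (e '' Set.Iic N).indicator f i =
      ∑' i, (e '' Set.Iic N)ᶜ.indicator f i := by
    rw [← hf.tsum_sub (hf.indicator _)]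
    refine tsum_congr fun i => ?_
    rw [Set.indicator_compl, Pi.sub_apply]
  let g : ℕ → ι := fun k => e (N + k.succPNat)
  have hg : Function.Injective g := fun j k h => by
    have := he h
    exact Nat.succPNat_injective (add_left_cancel this)
  have hgf : ∀ k, (e '' Set.Iic N)ᶜ.indicator f (g k) = f (g k) := fun k => by
    refine Set.indicator_of_mem ?_ f
    rintro ⟨n, hn, hne⟩
    have : N + k.succPNat ≤ N := he hne ▸ hn
    exact absurd this (not_le.2 (PNat.lt_add_right _ _))
  have h1 : ∑' k, f (g k) ≤ ∑' i, (e '' Set.Iic N)ᶜ.indicator f i := by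
    simp_rw [← hgf]
    exact tsum_comp_le_tsum_of_inj (hf.indicator _)
      (fun i => Set.indicator_nonneg (fun i _ => hf0 i) i) hg
  have h2 : ∀ k : ℕ, a * ((N : ℝ) + 1 + k) ^ (-p) ≤ f (g k) := fun k => by
    refine le_of_eq_of_le ?_ (hle (N + k.succPNat))
    congr 2
    rw [PNat.add_coe, Nat.succPNat_coe]
    push_cast
    ring
  have hsg : Summable fun k => f (g k) := hf.comp_injective hg
  have h3 : a * ∑' k : ℕ, ((N : ℝ) + 1 + k) ^ (-p) ≤ ∑' k, f (g k) := by
    rw [← tsum_mul_left]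
    exact (Summable.of_nonneg_of_le (fun k => by positivity) h2 hsg).tsum_le_tsum h2 hsg
  have h4 := rpow_le_tsum_tail hp (N : ℕ)
  -- `N + 1 ≤ 2 * N`, which is where the factor `2 ^ (p - 1)` comes from
  have h5 : (2 * (N : ℝ)) ^ (1 - p) ≤ ((N : ℝ) + 1) ^ (1 - p) :=
    Real.rpow_le_rpow_of_nonpos (by linarith) (by linarith) (by linarith)
  have h6 : (2 * (N : ℝ)) ^ (1 - p) = (N : ℝ) ^ (1 - p) / 2 ^ (p - 1) := by
    rw [Real.mul_rpow zero_le_two hN0.le, ← neg_sub p 1, Real.rpow_neg zero_le_two]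
    field_simp
  have h7 : (N : ℝ) ^ (1 - p) / 2 ^ (p - 1) / (p - 1) ≤ ∑' k : ℕ, ((N : ℝ) + 1 + k) ^ (-p) := by
    rw [div_le_iff₀' hp1, ← h6]
    exact h5.trans h4
  calc a * (N : ℝ) ^ (1 - p) / ((p - 1) * 2 ^ (p - 1))
      = a * ((N : ℝ) ^ (1 - p) / 2 ^ (p - 1) / (p - 1)) := by
        rw [div_div, mul_div_assoc, mul_comm (p - 1)]
    _ ≤ a * ∑' k : ℕ, ((N : ℝ) + 1 + k) ^ (-p) := mul_le_mul_of_nonneg_left h7 ha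
    _ ≤ _ := hcompl ▸ h3.trans h1

end Tail

end StochWave

end

theorem corollary2p6
    {H : Type*} [NormedAddCommGroup H] [InnerProductSpace ℝ H] [CompleteSpace H]
    [TopologicalSpace.SeparableSpace H]
    {T : ℝ} (hT : 0 < T)
    {Ω : Type*} {mΩ : MeasurableSpace Ω} (P : Measure Ω) [IsProbabilityMeasure P]
    (𝓕 : Filtration (Set.Icc (0 : ℝ) T) mΩ) (h𝓕 : StochWave.IsNormalFiltration P 𝓕)
    (W : Set.Icc (0 : ℝ) T → H → Ω → ℝ) (hW : StochWave.IsCylindricalWiener P 𝓕 W)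
    {ι : Type*} (b : HilbertBasis ι ℝ H) (Λ : StochWave.NegEigenvalues ι)
    (m : ι → ℝ) (hm : Summable fun i => |m i| ^ 2 / |Λ.val i|)
    (X : Set ι → Ω → Λ.WaveSpace)
    (hXmeas : ∀ I, StronglyMeasurable (X I))
    (hXrange : ∀ I ω, X I ω ∈ Set.range (Λ.waveProj I))
    (hX : ∀ I, StochWave.IsStochasticIntegral P W b
      (fun s => StochWave.expSemigroup Λ.waveOp (T - s) ∘L Λ.waveProj I ∘L Λ.noiseOp b m hm) (X I))
    {c p : ℝ} (hc : 0 < c) (hp : 1 < p)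
    (e : ℕ+ → ι) (he : Function.Bijective e)
    (hΛ : ∀ n : ℕ+, Λ.val (e n) = -c * (n : ℝ) ^ p) (N : ℕ+) :
    MemLp (X Set.univ) 2 P ∧ MemLp (X (e '' Set.Iic N)) 2 P ∧
    T * (⨅ i, |m i| ^ 2) * (N : ℝ) ^ (1 - p) / (c * (p - 1) * 2 ^ (p - 1))
      ≤ (∫ ω, ‖X Set.univ ω‖ ^ 2 ∂P) - ∫ ω, ‖X (e '' Set.Iic N) ω‖ ^ 2 ∂P := by
  obtain ⟨hL, hE⟩ := Λ.second_moment b m hm hT.le hW Set.univ (hX Set.univ)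
  obtain ⟨hLN, hEN⟩ := Λ.second_moment b m hm hT.le hW (e '' Set.Iic N) (hX _)
  refine ⟨hL, hLN, ?_⟩
  rw [hE, hEN, ← mul_sub, Set.indicator_univ]
  have ha : 0 ≤ (⨅ i, |m i| ^ 2) / c := div_nonneg (Real.iInf_nonneg fun i => by positivity) hc.le
  have hle : ∀ n : ℕ+, (⨅ i, |m i| ^ 2) / c * (n : ℝ) ^ (-p) ≤ |m (e n)| ^ 2 / |Λ.val (e n)| := by
    intro n
    have hn : (0 : ℝ) < n := by exact_mod_cast n.pos
    have hinf : (⨅ i, |m i| ^ 2) ≤ |m (e n)| ^ 2 :=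
      ciInf_le ⟨0, by rintro _ ⟨i, rfl⟩; positivity⟩ (e n)
    have hval : |Λ.val (e n)| = c * (n : ℝ) ^ p := by
      rw [hΛ, neg_mul, abs_neg, abs_of_pos (mul_pos hc (Real.rpow_pos_of_pos hn p))]
    rw [hval, Real.rpow_neg hn.le, ← div_eq_mul_inv, div_div]
    exact div_le_div_of_nonneg_right hinf (by positivity)
  refine le_of_eq_of_le ?_ (mul_le_mul_of_nonneg_left (StochWave.le_tsum_sub_tsum_indicator hm
    (fun i => by positivity) he.injective ha hp hle N) hT.le)
  have : (0 : ℝ) < p - 1 := sub_pos.2 hp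
  field_simp
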